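/- **Setting.** Let $\mu\in(0,1)$, $E=(0,0)$, $M=(1,0)$ in $\mathbb R^2$, and let $$H(q,p)=\tfrac12|p|^2+U(q),\qquad U(q)=-\frac{1-\mu}{|q-E|}-\frac{\mu}{|q-M|},\qquad (q,p)\in(\mathbb R^2\setminus\{E,M\})\times\mathbb R^2,$$ be the Hamiltonian of the Euler problem of two fixed centers. Put $l=\frac{1-\mu-\sqrt{\mu(1-\mu)}}{1-2\mu}$ if $\mu\ne\frac12$ and $l=\frac12$ if $\mu=\frac12$, so that $(l,0)$ is the saddle point of $U$, and let $c_J=H(l,0,0,0)=-1-2\sqrt{\mu(1-\mu)}$ be the critical Jacobi energy. For $c<c_J$ and $P\in\{E,M\}$ let $\Sigma_c^P\subset H^{-1}(c)$ be the component around $P$, i.e. the set of points of $H^{-1}(c)$ whose connected component in $H^{-1}(c)$ has a projection to the $q$-plane that accumulates at $P$. Regard $p$ as the base point and $q-P$ as the covector; the inverse stereographic projection $\mathbb R^2\to S^2=\mathbb R^2\cup\{\infty\}$ and its cotangent lift embed $\Sigma_c^P$ into $T^*\mathbb R^2\subset T^*S^2$. The regularized component $\overline{\Sigma_c^P}$ is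 the closure of the image in $T^*S^2$. A subset of $T^*S^2$ is *fiberwise convex* if, for every $x\in S^2$, its fiber over $x$ bounds a strictly convex domain, i.e. is the boundary of a compact strictly convex set with nonempty interior in the plane $T_x^*S^2\cong T_xS^2$. Let $$\kappa=\frac{U_{q_1q_1}U_{q_2}^2+U_{q_2q_2}U_{q_1}^2-2U_{q_1q_2}U_{q_1}U_{q_2}}{(U_{q_1}^2+U_{q_2}^2)^{3/2}}$$ be the curvature of the level curves of $U$. **Theorem.** (1) Let $0<\mu<\frac12$. There is $c_0<c_J$ such that for every $c\in(c_0,c_J)$ the regularized Earth component $\overline{\Sigma_c^E}\subset T^*S^2$ is not fiberwise convex. Moreover, there is $\delta>0$ such that $\kappa(q)<0$ for every $q=(q_1,q_2)$ with $U(q)=c_J$, $q_1<l$ and $|q-(l,0)|<\delta$. (2) Let $\mu=\frac12$. For every $c<c_J=-2$ both compact components $\overline{\Sigma_c^E}$ and $\overline{\Sigma_c^M}$ are fiberwise convex. Moreover, for every $p\in\mathbb R^2$ and $P\in\{E,M\}$, the planar curve $\{q:(q,p)\in\Sigma_c^P\}$, which is the part around $P$ of the curve $U=c-\frac12|p|^2$,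 bounds a strictly convex domain in $\mathbb R^2$ and has $\kappa>0$ at each of its points. -/

import Mathlib

open scoped RealInnerProductSpace

noncomputable section

namespace EulerProblem

/-! ### The Euler problem of two fixed centers -/

/-- The configuration plane (also used for the momentum plane), with the Euclidean norm. -/
abbrev Plane : Type := EuclideanSpace ℝ (Fin 2)

/-- Euclidean three-space, in which the unit two-sphere sits. -/
abbrev Space : Type := EuclideanSpace ℝ (Fin 3)

/-- The position of the Earth (mass `1 - μ`). -/
def earth : Plane := !₂[0, 0]

/-- The position of the Moon (mass `μ`). -/
def moon : Plane := !₂[1, 0]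

/-- The potential energy `U(q) = -(1-μ)/|q-E| - μ/|q-M|`. It is meaningful for `q ≠ E, M` only. -/
def potential (μ : ℝ) (q : Plane) : ℝ :=
  -(1 - μ) / ‖q - earth‖ - μ / ‖q - moon‖

/-- The Hamiltonian `H(q,p) = |p|²/2 + U(q)`. -/
def hamiltonian (μ : ℝ) (q p : Plane) : ℝ :=
  ‖p‖ ^ 2 / 2 + potential μ q

/-- The first coordinate `l` of the saddle point of the potential. -/
def saddleAbscissa (μ : ℝ) : ℝ :=
  if μ = 1 / 2 then 1 / 2 else (1 - μ - √(μ * (1 - μ))) / (1 - 2 * μ)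

/-- The saddle point `(l, 0)` of the potential. -/
def saddle (μ : ℝ) : Plane := !₂[saddleAbscissa μ, 0]

/-- The critical Jacobi energy `c_J = H(l, 0, 0, 0)`. -/
def criticalEnergy (μ : ℝ) : ℝ := hamiltonian μ (saddle μ) 0

/-- The energy hypersurface `H⁻¹(c)` in `(ℝ² ∖ {E, M}) × ℝ²`; a point is a pair `(q, p)`. -/
def energySurface (μ c : ℝ) : Set (Plane × Plane) :=
  {z | z.1 ≠ earth ∧ z.1 ≠ moon ∧ hamiltonian μ z.1 z.2 = c}

/-- The component of `H⁻¹(c)` around the primary `P` (`P = E` gives `Σ_c^E`, `P = M` gives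
`Σ_c^M`): the points of `H⁻¹(c)` whose connected component in `H⁻¹(c)` has a projection to the
`q`-plane that accumulates at `P`. -/
def primaryComponent (μ c : ℝ) (P : Plane) : Set (Plane × Plane) :=
  {z | z ∈ energySurface μ c ∧
    P ∈ closure (Prod.fst '' connectedComponentIn (energySurface μ c) z)}

/-! ### Regularization in the cotangent bundle of the sphere

The roles of position and momentum are switched: `p` is the base point, embedded in `S²` by the
inverse stereographic projection, and `q` is the fibre coordinate, transported by the cotangent
lift. We use the model `T*S² = {(x, y) : |x| = 1, ⟪x, y⟫ = 0} ⊆ ℝ³ × ℝ³`, in which `y` stands for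
the covector `⟪y, ·⟫` on the tangent plane `xᗮ`. -/

/-- Inverse stereographic projection `ℝ² → S² ∖ {north pole}`. The north pole is the point `∞`. -/
def invStereo (p : Plane) : Space :=
  !₂[2 * p 0 / (‖p‖ ^ 2 + 1), 2 * p 1 / (‖p‖ ^ 2 + 1), (‖p‖ ^ 2 - 1) / (‖p‖ ^ 2 + 1)]

/-- The covector at `invStereo p` that corresponds to the covector `q` at `p`. -/
def covectorLift (q p : Plane) : Space :=
  !₂[(‖p‖ ^ 2 + 1) / 2 * q 0 - ⟪q, p⟫ * p 0, (‖p‖ ^ 2 + 1) / 2 * q 1 - ⟪q, p⟫ * p 1, ⟪q, p⟫]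

/-- The model `T*S² ⊆ ℝ³ × ℝ³` of the cotangent bundle of the unit sphere. -/
def cotangentSphere : Set (Space × Space) := {z | ‖z.1‖ = 1 ∧ ⟪z.1, z.2⟫ = 0}

/-- The inclusion `T*ℝ² ⊆ T*S²` in which `p` is the base point. The position `q` is measured from
the primary `P` that is being regularized. -/
def toCotangentSphere (P : Plane) (z : Plane × Plane) : Space × Space :=
  (invStereo z.2, covectorLift (z.1 - P) z.2)

/-- The regularized component around the primary `P`: the closure in `T*S²` of the component. (The
set `cotangentSphere` is closed, so that the closure can be taken in `ℝ³ × ℝ³`.) -/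
def regularizedComponent (μ c : ℝ) (P : Plane) : Set (Space × Space) :=
  closure (toCotangentSphere P '' primaryComponent μ c P)

/-! ### Convexity and curvature -/

/-- `S` bounds a strictly convex domain: `S` is the boundary of a compact strictly convex set with
nonempty interior. -/
def BoundsStrictlyConvexDomain {V : Type*} [NormedAddCommGroup V] [NormedSpace ℝ V]
    (S : Set V) : Prop :=
  ∃ D : Set V, IsCompact D ∧ StrictConvex ℝ D ∧ (interior D).Nonempty ∧ frontier D = S

/-- A subset of `T*S²` is fiberwise convex if for every `x ∈ S²` its fibre over `x` bounds a
strictly convex domain in the plane `xᗮ = T_x S² ≅ T_x* S²`. -/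
def FiberwiseConvex (S : Set (Space × Space)) : Prop :=
  ∀ x : Space, ‖x‖ = 1 →
    BoundsStrictlyConvexDomain {y : ((ℝ ∙ x)ᗮ : Submodule ℝ Space) | (x, (y : Space)) ∈ S}

/-- The partial derivative of `f` with respect to the `i`-th coordinate. -/
def partialDeriv (i : Fin 2) (f : Plane → ℝ) (q : Plane) : ℝ :=
  fderiv ℝ f q (EuclideanSpace.single i 1)

/-- The curvature at `q` of the level curve of `f` through `q`, with the sign for which it is
positive where the sublevel set is locally strictly convex. It is meaningful where the gradient of
`f` does not vanish. -/
def levelCurvature (f : Plane → ℝ) (q : Plane) : ℝ :=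
  (partialDeriv 0 (partialDeriv 0 f) q * partialDeriv 1 f q ^ 2
    + partialDeriv 1 (partialDeriv 1 f) q * partialDeriv 0 f q ^ 2
    - 2 * partialDeriv 0 (partialDeriv 1 f) q * partialDeriv 0 f q * partialDeriv 1 f q)
  / √(partialDeriv 0 f q ^ 2 + partialDeriv 1 f q ^ 2) ^ 3

/-! ### Sanity checks for the definitions -/

theorem isClosed_cotangentSphere : IsClosed cotangentSphere := by
  have h1 : IsClosed {z : Space × Space | ‖z.1‖ = 1} :=
    isClosed_eq (by fun_prop) continuous_const
  have h2 : IsClosed {z : Space × Space | ⟪z.1, z.2⟫ = 0} :=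
    isClosed_eq (by fun_prop) continuous_const
  exact h1.inter h2

theorem toCotangentSphere_mem (P : Plane) (z : Plane × Plane) :
    toCotangentSphere P z ∈ cotangentSphere := by
  obtain ⟨q, p⟩ := z
  have hp : (‖p‖ ^ 2 + 1) ≠ 0 := by positivity
  have hn : ‖p‖ ^ 2 = p 0 ^ 2 + p 1 ^ 2 := by
    rw [EuclideanSpace.real_norm_sq_eq, Fin.sum_univ_two]
  constructor
  · have : ‖invStereo p‖ ^ 2 = 1 := by
      rw [EuclideanSpace.real_norm_sq_eq, Fin.sum_univ_three]
      simp only [invStereo, PiLp.toLp_apply, Matrix.cons_val_zero, Matrix.cons_val_one,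
        Matrix.cons_val]
      field_simp
      rw [hn]; ring
    have h0 := norm_nonneg (invStereo p)
    change ‖invStereo p‖ = 1
    nlinarith
  · change ⟪invStereo p, covectorLift (q - P) p⟫ = 0
    generalize q - P = r
    simp only [invStereo, covectorLift, PiLp.inner_apply, Fin.sum_univ_three, Fin.sum_univ_two,
      Matrix.cons_val_zero, Matrix.cons_val_one, Matrix.cons_val,
      RCLike.inner_apply, conj_trivial]
    field_simp
    rw [hn]; ring

/-- `covectorLift q p` is the image of the covector `q` under the cotangent lift of `invStereo`:
it pairs with the push-forward of `v` as `q` pairs with `v`. -/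
theorem exists_hasLineDerivAt_invStereo (q p v : Plane) :
    ∃ w, HasLineDerivAt ℝ invStereo w p v ∧ ⟪covectorLift q p, w⟫ = ⟪q, v⟫ := by
  set a : ℝ := 2 * (p 0 * v 0 + p 1 * v 1) with ha
  set b : ℝ := p 0 ^ 2 + p 1 ^ 2 + 1 with hb
  have hb0 : b ≠ 0 := by positivity
  have hn : ∀ t : ℝ, ‖p + t • v‖ ^ 2 = (p 0 + t * v 0) ^ 2 + (p 1 + t * v 1) ^ 2 := by
    intro t
    rw [EuclideanSpace.real_norm_sq_eq, Fin.sum_univ_two]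
    simp
  have hp : ‖p‖ ^ 2 = p 0 ^ 2 + p 1 ^ 2 := by
    rw [EuclideanSpace.real_norm_sq_eq, Fin.sum_univ_two]
  have hc : ∀ i, HasDerivAt (fun t : ℝ => p i + t * v i) (v i) 0 := fun i => by
    simpa using ((hasDerivAt_id (0 : ℝ)).mul_const (v i)).const_add (p i)
  have hs : HasDerivAt (fun t : ℝ => (p 0 + t * v 0) ^ 2 + (p 1 + t * v 1) ^ 2) a 0 := by
    refine (((hc 0).pow 2).add ((hc 1).pow 2)).congr_deriv ?_
    simp [ha, mul_add, mul_assoc]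
  have hd : (p 0 + 0 * v 0) ^ 2 + (p 1 + 0 * v 1) ^ 2 + 1 = b := by simp [hb]
  have h0 : (p 0 + 0 * v 0) ^ 2 + (p 1 + 0 * v 1) ^ 2 + 1 ≠ 0 := by rw [hd]; exact hb0
  refine ⟨!₂[(2 * v 0 * b - 2 * p 0 * a) / b ^ 2, (2 * v 1 * b - 2 * p 1 * a) / b ^ 2,
    (a * b - (b - 2) * a) / b ^ 2], ?_, ?_⟩
  · rw [HasLineDerivAt, hasDerivAt_iff_hasFDerivAt, ← hasFDerivWithinAt_univ,
      hasFDerivWithinAt_euclidean]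
    intro i
    have key : HasDerivAt (fun t : ℝ => invStereo (p + t • v) i)
        ((!₂[(2 * v 0 * b - 2 * p 0 * a) / b ^ 2, (2 * v 1 * b - 2 * p 1 * a) / b ^ 2,
          (a * b - (b - 2) * a) / b ^ 2] : Space) i) 0 := by
      fin_cases i
      · have := ((hc 0).const_mul 2).div (hs.add_const 1) h0
        simp only [hd] at this
        refine (this.congr_deriv ?_).congr_of_eventuallyEq (.of_forall fun t => ?_)
        · simp
        · simp [invStereo, hn]
      · have := ((hc 1).const_mul 2).div (hs.add_const 1) h0
        simp only [hd] at this
        refine (this.congr_deriv ?_).congr_of_eventuallyEq (.of_forall fun t => ?_)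
        · simp
        · simp [invStereo, hn]
      · have := (hs.sub_const 1).div (hs.add_const 1) h0
        simp only [hd] at this
        refine (this.congr_deriv ?_).congr_of_eventuallyEq (.of_forall fun t => ?_)
        · simp [hb]; ring
        · simp [invStereo, hn]
    rw [hasFDerivWithinAt_univ]
    refine key.hasFDerivAt.congr_fderiv ?_
    ext; simp
  · simp only [covectorLift, PiLp.inner_apply, Fin.sum_univ_three, Fin.sum_univ_two,
      Matrix.cons_val_zero, Matrix.cons_val_one, Matrix.cons_val,
      RCLike.inner_apply, conj_trivial]
    rw [hp, ← hb]
    field_simp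
    rw [hb, ha]; ring

/-- The closed form of the critical Jacobi energy. -/
theorem criticalEnergy_eq {μ : ℝ} (h0 : 0 < μ) (h1 : μ < 1) :
    criticalEnergy μ = -1 - 2 * √(μ * (1 - μ)) := by
  obtain ⟨x, hx⟩ : ∃ x, x = √μ := ⟨_, rfl⟩
  obtain ⟨y, hy⟩ : ∃ y, y = √(1 - μ) := ⟨_, rfl⟩
  have hx0 : 0 < x := by rw [hx]; positivity
  have hy0 : 0 < y := by rw [hy]; exact Real.sqrt_pos.2 (by linarith)
  have hx2 : x ^ 2 = μ := by rw [hx]; exact Real.sq_sqrt h0.le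
  have hy2 : y ^ 2 = 1 - μ := by rw [hy]; exact Real.sq_sqrt (by linarith)
  have hr : √(μ * (1 - μ)) = x * y := by rw [Real.sqrt_mul h0.le, ← hx, ← hy]
  have hl : saddleAbscissa μ = y / (x + y) := by
    rw [saddleAbscissa]
    split_ifs with h
    · have : x = y := by
        rw [hx, hy, h]; norm_num
      rw [this]; field_simp; norm_num
    · have hne : y - x ≠ 0 := by
        intro h'
        have : y = x := by linarith
        rw [this, hx2] at hy2
        exact h (by linarith)
      rw [hr, ← hy2, show 1 - 2 * μ = (y - x) * (x + y) by linear_combination hx2 - hy2]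
      field_simp
  have hE : ‖saddle μ - earth‖ = y / (x + y) := by
    rw [EuclideanSpace.norm_eq, Fin.sum_univ_two]
    simp only [saddle, earth, hl]
    simp [Real.sqrt_sq_eq_abs, abs_div, abs_of_pos hy0, abs_of_pos (add_pos hx0 hy0)]
  have hM : ‖saddle μ - moon‖ = x / (x + y) := by
    rw [EuclideanSpace.norm_eq, Fin.sum_univ_two]
    simp only [saddle, moon, hl]
    simp
    rw [show y / (x + y) - 1 = -(x / (x + y)) by field_simp; ring, neg_sq,
      Real.sqrt_sq_eq_abs, abs_of_pos (by positivity)]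
  rw [criticalEnergy, hamiltonian, potential, hE, hM, hr, ← hy2]
  have hm : μ / (x / (x + y)) = x * (x + y) := by rw [← hx2]; field_simp
  rw [hm]
  have : x ^ 2 + y ^ 2 = 1 := by linarith
  simp
  field_simp
  linear_combination (-1 : ℝ) * this

end EulerProblem

end

open EulerProblem

/-! The level curves of the potential `U` are compared with their tangent lines through the second
derivative of `U` along the tangent vector (the gradient turned by a right angle), which is the
numerator of the curvature. Written in terms of the inverse distances `a`, `b` to the two centers,
the attractions `A = (1 - μ) a²`, `B = μ b²` and the cosine `C` of the angle between the directions
to the centers, it is `A a ((A + B C)² - 2 B² (1 - C²)) + B b ((A C + B)² - 2 A² (1 - C²))`, and the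
law of cosines expresses `C` through `a` and `b`.

*Unequal masses.* On the critical level the distances can be parametrized rationally by a parameter
`η`, which is positive exactly to the left of the saddle point; the numerator is then `η³` times a
positive factor times a function with the value `8 (2 μ - 1) < 0` at `η = 0`
(`curvNumerator_critical`). So the curvature is negative near the saddle point. At such a point the
tangent line lies locally in `U < c_J`, away from the point of contact. For `c` slightly below `c_J`
the level curve `U = c` therefore passes above two points of the tangent line and below the point of
contact. With the symmetry in the axis this puts a point of the curve on an open segment between two
points of any convex set that contains the curve
(`not_boundsStrictlyConvexDomain_of_chord`). The fiber at `p = 0` is a copy of this curve.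

*Equal masses.* With `z = a / b + b / a` the numerator is a positive multiple of
`z³ - z² - 2 z - 1 + 2 (z - 1) C + 3 C²`, and `U < -2` means `(z + 2) (z - 2 C) > 16`, which makes it
positive (`equal_mass_inequality`). To pass from positive curvature to convexity, a segment with
endpoints in the sublevel region is blown up from the center, where the potential increases along
rays (`potential_smul_lt`); a segment that leaves the region would at some moment touch the level
curve from the inside, contrary to the second derivative test (`harmonicDist_lt_of_mem_segment`). The
fibers of the regularized component over points other than the north pole are linear images of these
curves, as the closure adds nothing there. The energy equation, written in coordinates of the sphere
(`norm_covectorLift_mul`), shows that the fiber over the north pole is the circle of radius `1 / 2`.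
The reflection at the midpoint of the centers carries everything over to the second center.

In both cases the component around the center `E` below the critical energy is identified by the
abscissa: the rays into the center stay in the energy surface when the momentum is adjusted, and the
potential is at least `c_J` on the vertical line through the saddle point
(`mem_primaryComponent_earth_iff`). -/

noncomputable section

namespace EulerProblem

open Filter Topology

/-! ### Derivatives of the potential -/

theorem hasFDerivAt_inv_norm_sub {P q : Plane} (h : q ≠ P) :
    HasFDerivAt (fun x : Plane => ‖x - P‖⁻¹) (-(‖q - P‖⁻¹ ^ 3) • innerSL ℝ (q - P)) q := by
  have hn : ‖q - P‖ ≠ 0 := norm_ne_zero_iff.2 (sub_ne_zero.2 h)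
  have h1 := (((hasFDerivAt_id q).sub_const P).norm_sq.sqrt (by simpa using hn))
  simp only [id, Real.sqrt_sq (norm_nonneg _)] at h1
  refine ((hasDerivAt_inv hn).comp_hasFDerivAt q h1).congr_fderiv ?_
  ext v
  simp
  field_simp

/-- The derivative of the potential at `q` in the direction `v`. -/
def potentialDeriv (μ : ℝ) (v q : Plane) : ℝ :=
  (1 - μ) * (‖q - earth‖⁻¹ ^ 3 * ⟪q - earth, v⟫) + μ * (‖q - moon‖⁻¹ ^ 3 * ⟪q - moon, v⟫)

/-- The second derivative (Hessian form) of the potential at `q` in the directions `v` and `w`. -/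
def potentialHess (μ : ℝ) (v w q : Plane) : ℝ :=
  (1 - μ) * (‖q - earth‖⁻¹ ^ 3 * ⟪v, w⟫
      - 3 * ‖q - earth‖⁻¹ ^ 5 * ⟪q - earth, v⟫ * ⟪q - earth, w⟫)
    + μ * (‖q - moon‖⁻¹ ^ 3 * ⟪v, w⟫
      - 3 * ‖q - moon‖⁻¹ ^ 5 * ⟪q - moon, v⟫ * ⟪q - moon, w⟫)

theorem potential_eq (μ : ℝ) (q : Plane) :
    potential μ q = -((1 - μ) * ‖q - earth‖⁻¹ + μ * ‖q - moon‖⁻¹) := by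
  rw [potential]; ring

theorem hasFDerivAt_potential (μ : ℝ) {q : Plane} (hE : q ≠ earth) (hM : q ≠ moon) :
    ∃ L : Plane →L[ℝ] ℝ, HasFDerivAt (potential μ) L q ∧ ∀ v, L v = potentialDeriv μ v q := by
  refine ⟨_, (((hasFDerivAt_inv_norm_sub hE).const_mul (1 - μ)).add
    ((hasFDerivAt_inv_norm_sub hM).const_mul μ)).neg.congr_of_eventuallyEq
    (.of_forall fun x => potential_eq μ x), fun v => ?_⟩
  simp [potentialDeriv, inner_sub_left]
  ring

theorem hasFDerivAt_inv_norm_pow_mul_inner {P q : Plane} (v : Plane) (h : q ≠ P) :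
    ∃ L : Plane →L[ℝ] ℝ, HasFDerivAt (fun x : Plane => ‖x - P‖⁻¹ ^ 3 * ⟪x - P, v⟫) L q ∧
      ∀ w, L w = ‖q - P‖⁻¹ ^ 3 * ⟪v, w⟫ - 3 * ‖q - P‖⁻¹ ^ 5 * ⟪q - P, v⟫ * ⟪q - P, w⟫ := by
  have hi : HasFDerivAt (fun x : Plane => ⟪x - P, v⟫) (innerSL ℝ v) q := by
    have : HasFDerivAt (fun x : Plane => innerSL ℝ v (x - P)) (innerSL ℝ v) q :=
      (innerSL ℝ v).hasFDerivAt.comp q ((hasFDerivAt_id q).sub_const P)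
    refine this.congr_of_eventuallyEq (.of_forall fun x => ?_)
    simp only [innerSL_apply_apply]
    exact real_inner_comm _ _
  refine ⟨_, ((hasFDerivAt_inv_norm_sub h).pow 3).mul hi, fun w => ?_⟩
  simp [inner_sub_left]
  ring

theorem hasFDerivAt_potentialDeriv (μ : ℝ) (v : Plane) {q : Plane} (hE : q ≠ earth)
    (hM : q ≠ moon) :
    ∃ L : Plane →L[ℝ] ℝ, HasFDerivAt (potentialDeriv μ v) L q ∧
      ∀ w, L w = potentialHess μ v w q := by
  obtain ⟨L₁, h₁, e₁⟩ := hasFDerivAt_inv_norm_pow_mul_inner v hE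
  obtain ⟨L₂, h₂, e₂⟩ := hasFDerivAt_inv_norm_pow_mul_inner v hM
  refine ⟨_, (h₁.const_mul (1 - μ)).add (h₂.const_mul μ), fun w => ?_⟩
  simp [e₁, e₂, potentialHess]

theorem eventually_ne_centers {q : Plane} (hE : q ≠ earth) (hM : q ≠ moon) :
    ∀ᶠ x in 𝓝 q, x ≠ earth ∧ x ≠ moon :=
  (eventually_ne_nhds hE).and (eventually_ne_nhds hM)

theorem partialDeriv_potential (μ : ℝ) (i : Fin 2) {q : Plane} (hE : q ≠ earth) (hM : q ≠ moon) :
    partialDeriv i (potential μ) q = potentialDeriv μ (EuclideanSpace.single i 1) q := by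
  obtain ⟨L, h, e⟩ := hasFDerivAt_potential μ hE hM
  rw [partialDeriv, h.fderiv, e]

theorem partialDeriv_partialDeriv_potential (μ : ℝ) (i j : Fin 2) {q : Plane} (hE : q ≠ earth)
    (hM : q ≠ moon) :
    partialDeriv i (partialDeriv j (potential μ)) q =
      potentialHess μ (EuclideanSpace.single j 1) (EuclideanSpace.single i 1) q := by
  obtain ⟨L, h, e⟩ := hasFDerivAt_potentialDeriv μ (EuclideanSpace.single j 1) hE hM
  have : partialDeriv j (potential μ) =ᶠ[𝓝 q] potentialDeriv μ (EuclideanSpace.single j 1) :=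
    (eventually_ne_centers hE hM).mono fun x hx => partialDeriv_potential μ j hx.1 hx.2
  rw [partialDeriv, this.fderiv_eq, h.fderiv, e]

/-- The vector tangent to the level curve of the potential: the gradient turned by a right angle. -/
def levelTangent (μ : ℝ) (q : Plane) : Plane :=
  !₂[-potentialDeriv μ (EuclideanSpace.single 1 1) q, potentialDeriv μ (EuclideanSpace.single 0 1) q]

theorem norm_sq_eq (q : Plane) : ‖q‖ ^ 2 = q 0 ^ 2 + q 1 ^ 2 := by
  rw [EuclideanSpace.real_norm_sq_eq, Fin.sum_univ_two]

theorem inner_eq (q v : Plane) : ⟪q, v⟫ = q 0 * v 0 + q 1 * v 1 := by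
  simp only [PiLp.inner_apply, Fin.sum_univ_two, RCLike.inner_apply, conj_trivial]
  ring

theorem levelTangent_ne_zero {μ : ℝ} {q : Plane}
    (h : potentialHess μ (levelTangent μ q) (levelTangent μ q) q ≠ 0) : levelTangent μ q ≠ 0 := by
  intro h'
  rw [h'] at h
  simp [potentialHess] at h

theorem potentialDeriv_levelTangent (μ : ℝ) (q : Plane) :
    potentialDeriv μ (levelTangent μ q) q = 0 := by
  simp only [potentialDeriv, levelTangent, inner_eq]
  simp
  ring

/-- The numerator of the curvature is the second derivative along the tangent vector. -/
theorem levelCurvature_potential (μ : ℝ) {q : Plane} (hE : q ≠ earth) (hM : q ≠ moon) :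
    levelCurvature (potential μ) q =
      potentialHess μ (levelTangent μ q) (levelTangent μ q) q / ‖levelTangent μ q‖ ^ 3 := by
  rw [levelCurvature, EuclideanSpace.norm_eq, Fin.sum_univ_two]
  simp only [partialDeriv_partialDeriv_potential μ _ _ hE hM, partialDeriv_potential μ _ hE hM,
    Real.norm_eq_abs, sq_abs]
  congr 1
  · simp only [potentialHess, levelTangent, inner_eq]
    simp
    ring
  · simp [levelTangent, add_comm]

/-- A vector in the kernel of the derivative is a multiple of the tangent vector, so that the Hessian
form on it is a multiple of the curvature numerator. -/
theorem potentialHess_of_potentialDeriv_eq_zero {μ : ℝ} {q v : Plane}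
    (h0 : potentialDeriv μ v q = 0) :
    ‖levelTangent μ q‖ ^ 2 * ‖levelTangent μ q‖ ^ 2 * potentialHess μ v v q =
      ⟪v, levelTangent μ q⟫ ^ 2 * potentialHess μ (levelTangent μ q) (levelTangent μ q) q := by
  set a := potentialDeriv μ (EuclideanSpace.single 0 1) q with ha
  set b := potentialDeriv μ (EuclideanSpace.single 1 1) q with hb
  have hv : a * v 0 + b * v 1 = 0 := by
    rw [← h0, ha, hb]
    simp only [potentialDeriv, inner_eq]
    simp
    ring
  have e0 : (a ^ 2 + b ^ 2) * v 0 = (-b * v 0 + a * v 1) * -b := by linear_combination a * hv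
  have e1 : (a ^ 2 + b ^ 2) * v 1 = (-b * v 0 + a * v 1) * a := by linear_combination b * hv
  have hn : ‖levelTangent μ q‖ ^ 2 = a ^ 2 + b ^ 2 := by
    rw [norm_sq_eq]; simp [levelTangent, ← ha, ← hb]; ring
  have hi : ⟪v, levelTangent μ q⟫ = -b * v 0 + a * v 1 := by
    rw [inner_eq]; simp [levelTangent, ← ha, ← hb]; ring
  have hs : ∀ (r : ℝ) (w : Plane), potentialHess μ (r • w) (r • w) q
      = r ^ 2 * potentialHess μ w w q := by
    intro r w
    simp only [potentialHess, inner_smul_left, inner_smul_right, conj_trivial]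
    ring
  rw [hn, hi, ← hs, ← sq, ← hs]
  have : (a ^ 2 + b ^ 2) • v = (-b * v 0 + a * v 1) • levelTangent μ q := by
    ext i
    fin_cases i
    · simpa [levelTangent, ← ha, ← hb] using e0
    · simpa [levelTangent, ← ha, ← hb] using e1
  rw [this]

/-- The strict second derivative test. -/
theorem eventually_lt_of_deriv_deriv_neg {f f' : ℝ → ℝ} {f'' x : ℝ}
    (hf : ∀ᶠ t in 𝓝 x, HasDerivAt f (f' t) t) (hf' : HasDerivAt f' f'' x) (h0 : f' x = 0)
    (hneg : f'' < 0) : ∀ᶠ t in 𝓝 x, t ≠ x → f t < f x := by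
  -- Half of the second derivative is removed, which leaves a function with a local maximum.
  have hd : ∀ᶠ t in 𝓝 x, HasDerivAt (fun s => f s - f'' / 4 * (s - x) ^ 2)
      (f' t - f'' / 2 * (t - x)) t := by
    filter_upwards [hf] with t ht
    refine (ht.sub ((((hasDerivAt_id t).sub_const x).pow 2).const_mul (f'' / 4))).congr_deriv ?_
    simp; ring
  have hdd : HasDerivAt (fun t => f' t - f'' / 2 * (t - x)) (f'' / 2) x := by
    refine (hf'.sub (((hasDerivAt_id x).sub_const x).const_mul (f'' / 2))).congr_deriv ?_
    ring
  have he : deriv (fun s => f s - f'' / 4 * (s - x) ^ 2) =ᶠ[𝓝 x]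
      fun t => f' t - f'' / 2 * (t - x) := hd.mono fun t ht => ht.deriv
  have hm := isLocalMax_of_deriv_deriv_neg (f := fun s => f s - f'' / 4 * (s - x) ^ 2) (x₀ := x)
    (by rw [he.deriv_eq, hdd.deriv]; linarith) (by rw [he.eq_of_nhds, h0]; ring)
    hd.self_of_nhds.continuousAt
  filter_upwards [hm] with t ht hne
  have : 0 < (t - x) ^ 2 := by have := sub_ne_zero.2 hne; positivity
  simp only [sub_self] at ht
  nlinarith

/-- Along a line, the first and second derivatives of the potential are `potentialDeriv` and
`potentialHess`. -/
theorem hasDerivAt_potential_line (μ : ℝ) {q : Plane} (v : Plane) (hE : q ≠ earth) (hM : q ≠ moon) :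
    (∀ᶠ t in 𝓝 (0 : ℝ), HasDerivAt (fun s : ℝ => potential μ (q + s • v))
      (potentialDeriv μ v (q + t • v)) t) ∧
    HasDerivAt (fun s : ℝ => potentialDeriv μ v (q + s • v)) (potentialHess μ v v q) 0 := by
  have hl : ∀ t : ℝ, HasDerivAt (fun s : ℝ => q + s • v) v t := fun t => by
    simpa using ((hasDerivAt_id t).smul_const v).const_add q
  have hc : Tendsto (fun s : ℝ => q + s • v) (𝓝 0) (𝓝 q) := by
    simpa using (hl 0).continuousAt.tendsto
  constructor
  · filter_upwards [hc.eventually (eventually_ne_centers hE hM)] with t ht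
    obtain ⟨L, h, e⟩ := hasFDerivAt_potential μ ht.1 ht.2
    rw [← e]
    exact h.comp_hasDerivAt t (hl t)
  · obtain ⟨L, h, e⟩ := hasFDerivAt_potentialDeriv μ v hE hM
    rw [← e]
    have h' : HasFDerivAt (potentialDeriv μ v) L (q + (0 : ℝ) • v) := by simpa using h
    exact h'.comp_hasDerivAt 0 (hl 0)

/-- Where the curvature of the level curve is positive, the potential has a strict local minimum
along every line tangent to the level curve. -/
theorem not_isLocalMax_line {μ : ℝ} {q v : Plane} (hv : v ≠ 0) (hE : q ≠ earth) (hM : q ≠ moon)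
    (hpos : 0 < potentialHess μ (levelTangent μ q) (levelTangent μ q) q) :
    ¬ IsLocalMax (fun s : ℝ => potential μ (q + s • v)) 0 := by
  intro hmax
  obtain ⟨h1, h2⟩ := hasDerivAt_potential_line μ v hE hM
  have h0 : potentialDeriv μ v q = 0 := by
    simpa using hmax.hasDerivAt_eq_zero h1.self_of_nhds
  have hTn : 0 < ‖levelTangent μ q‖ := norm_pos_iff.2 (levelTangent_ne_zero hpos.ne')
  have key := potentialHess_of_potentialDeriv_eq_zero h0
  have hin : ⟪v, levelTangent μ q⟫ ≠ 0 := by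
    intro h
    set a := potentialDeriv μ (EuclideanSpace.single 0 1) q with ha
    set b := potentialDeriv μ (EuclideanSpace.single 1 1) q with hb
    have e1 : a * v 0 + b * v 1 = 0 := by
      rw [← h0, ha, hb]
      simp only [potentialDeriv, inner_eq]
      simp
      ring
    have e2 : -b * v 0 + a * v 1 = 0 := by
      rw [← h, inner_eq]; simp [levelTangent, ← ha, ← hb]; ring
    have hab : a ^ 2 + b ^ 2 ≠ 0 := by
      have : ‖levelTangent μ q‖ ^ 2 = a ^ 2 + b ^ 2 := by
        rw [norm_sq_eq]; simp [levelTangent, ← ha, ← hb]; ring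
      rw [← this]; positivity
    apply hv
    ext i
    fin_cases i
    · exact (mul_eq_zero.1 (by linear_combination a * e1 - b * e2 :
        (a ^ 2 + b ^ 2) * v 0 = 0)).resolve_left hab
    · exact (mul_eq_zero.1 (by linear_combination b * e1 + a * e2 :
        (a ^ 2 + b ^ 2) * v 1 = 0)).resolve_left hab
  have hpos' : 0 < potentialHess μ v v q := by
    have h3 : 0 < ‖levelTangent μ q‖ ^ 2 * ‖levelTangent μ q‖ ^ 2 := by positivity
    have h4 : 0 < ⟪v, levelTangent μ q⟫ ^ 2 *
        potentialHess μ (levelTangent μ q) (levelTangent μ q) q := by positivity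
    rw [← key] at h4
    exact pos_of_mul_pos_right h4 h3.le
  have hlt := eventually_lt_of_deriv_deriv_neg (f := fun s : ℝ => -potential μ (q + s • v))
    (f' := fun s : ℝ => -potentialDeriv μ v (q + s • v)) (f'' := -potentialHess μ v v q) (x := 0)
    (h1.mono fun t ht => ht.neg) h2.neg (by simp [h0]) (by linarith)
  obtain ⟨t, ⟨ht1, ht2⟩, ht3⟩ :=
    (((hlt.and hmax).filter_mono nhdsWithin_le_nhds).and
      (self_mem_nhdsWithin : ∀ᶠ t in 𝓝[≠] (0 : ℝ), t ∈ ({0}ᶜ : Set ℝ))).exists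
  have := ht1 ht3
  linarith

/-- Where the curvature of the level curve is negative, the potential has a strict local maximum
along the line tangent to the level curve. -/
theorem eventually_potential_levelTangent_lt {μ : ℝ} {q : Plane} (hE : q ≠ earth) (hM : q ≠ moon)
    (hneg : potentialHess μ (levelTangent μ q) (levelTangent μ q) q < 0) :
    ∀ᶠ s : ℝ in 𝓝 0, s ≠ 0 → potential μ (q + s • levelTangent μ q) < potential μ q := by
  obtain ⟨h1, h2⟩ := hasDerivAt_potential_line μ (levelTangent μ q) hE hM
  simpa using eventually_lt_of_deriv_deriv_neg h1 h2
    (by simp [potentialDeriv_levelTangent]) hneg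

/-! ### The sign of the curvature -/

theorem inv_norm_sq_mul {P q : Plane} (h : q ≠ P) :
    ‖q - P‖⁻¹ ^ 2 * ((q 0 - P 0) ^ 2 + (q 1 - P 1) ^ 2) = 1 := by
  have hn : ‖q - P‖ ≠ 0 := norm_ne_zero_iff.2 (sub_ne_zero.2 h)
  have := norm_sq_eq (q - P)
  simp only [PiLp.sub_apply] at this
  rw [← this]
  field_simp

/-- The cosine of the angle at `q` between the directions to the two centers. -/
def cosCenters (q : Plane) : ℝ :=
  (q 0 * (q 0 - 1) + q 1 ^ 2) * ‖q - earth‖⁻¹ * ‖q - moon‖⁻¹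

theorem earth_zero : earth 0 = 0 := by simp [earth]
theorem earth_one : earth 1 = 0 := by simp [earth]
theorem moon_zero : moon 0 = 1 := by simp [moon]
theorem moon_one : moon 1 = 0 := by simp [moon]

theorem one_sub_cosCenters_sq {q : Plane} (hE : q ≠ earth) (hM : q ≠ moon) :
    1 - cosCenters q ^ 2 = q 1 ^ 2 * ‖q - earth‖⁻¹ ^ 2 * ‖q - moon‖⁻¹ ^ 2 := by
  have h1 := inv_norm_sq_mul hE
  have h2 := inv_norm_sq_mul hM
  simp only [earth_zero, earth_one, moon_zero, moon_one, sub_zero] at h1 h2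
  rw [cosCenters]
  generalize ‖q - earth‖⁻¹ = a at *
  generalize ‖q - moon‖⁻¹ = b at *
  generalize q 0 = x at *
  generalize q 1 = y at *
  linear_combination (-1) * h1 - a ^ 2 * (x ^ 2 + y ^ 2) * h2

/-- The law of cosines for the triangle formed by `q` and the two centers. -/
theorem law_of_cosines {q : Plane} (hE : q ≠ earth) (hM : q ≠ moon) :
    ‖q - earth‖⁻¹ ^ 2 * ‖q - moon‖⁻¹ ^ 2 = ‖q - earth‖⁻¹ ^ 2 + ‖q - moon‖⁻¹ ^ 2
      - 2 * ‖q - earth‖⁻¹ * ‖q - moon‖⁻¹ * cosCenters q := by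
  have h1 := inv_norm_sq_mul hE
  have h2 := inv_norm_sq_mul hM
  simp only [earth_zero, earth_one, moon_zero, moon_one, sub_zero] at h1 h2
  rw [cosCenters]
  generalize ‖q - earth‖⁻¹ = a at *
  generalize ‖q - moon‖⁻¹ = b at *
  generalize q 0 = x at *
  generalize q 1 = y at *
  linear_combination b ^ 2 * h1 + a ^ 2 * h2

theorem neg_one_le_cosCenters {q : Plane} (hE : q ≠ earth) (hM : q ≠ moon) :
    -1 ≤ cosCenters q := by
  have h := one_sub_cosCenters_sq hE hM
  have : 0 ≤ q 1 ^ 2 * ‖q - earth‖⁻¹ ^ 2 * ‖q - moon‖⁻¹ ^ 2 := by positivity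
  nlinarith

/-- The curvature numerator in terms of the attractions `A`, `B` of the two centers and the angle
between their directions. -/
def curvNumerator (a b A B C : ℝ) : ℝ :=
  A * a * ((A + B * C) ^ 2 - 2 * B ^ 2 * (1 - C ^ 2))
    + B * b * ((A * C + B) ^ 2 - 2 * A ^ 2 * (1 - C ^ 2))

theorem potentialHess_levelTangent (μ : ℝ) {q : Plane} (hE : q ≠ earth) (hM : q ≠ moon) :
    potentialHess μ (levelTangent μ q) (levelTangent μ q) q =
      curvNumerator ‖q - earth‖⁻¹ ‖q - moon‖⁻¹ ((1 - μ) * ‖q - earth‖⁻¹ ^ 2)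
        (μ * ‖q - moon‖⁻¹ ^ 2) (cosCenters q) := by
  have h1 := inv_norm_sq_mul hE
  have h2 := inv_norm_sq_mul hM
  have h3 := one_sub_cosCenters_sq hE hM
  rw [curvNumerator, h3]
  simp only [earth_zero, earth_one, moon_zero, moon_one, sub_zero] at h1 h2
  simp only [potentialHess, cosCenters, inner_eq]
  have e0 : levelTangent μ q 0 = -((1 - μ) * (‖q - earth‖⁻¹ ^ 3 * q 1)
      + μ * (‖q - moon‖⁻¹ ^ 3 * q 1)) := by
    simp [levelTangent, potentialDeriv, inner_eq, earth_zero, earth_one, moon_zero, moon_one]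
  have e1 : levelTangent μ q 1 = ((1 - μ) * (‖q - earth‖⁻¹ ^ 3 * q 0)
      + μ * (‖q - moon‖⁻¹ ^ 3 * (q 0 - 1))) := by
    simp [levelTangent, potentialDeriv, inner_eq, earth_zero, earth_one, moon_zero, moon_one]
  simp only [PiLp.sub_apply, earth_zero, earth_one, moon_zero, moon_one, sub_zero]
  rw [e0, e1]
  generalize ‖q - earth‖⁻¹ = a at *
  generalize ‖q - moon‖⁻¹ = b at *
  generalize q 0 = x at *
  generalize q 1 = y at *
  have ha3 : a ^ 3 = a ^ 5 * (x ^ 2 + y ^ 2) := by linear_combination (-a ^ 3) * h1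
  have hb3 : b ^ 3 = b ^ 5 * ((x - 1) ^ 2 + y ^ 2) := by linear_combination (-b ^ 3) * h2
  have hA : (1 - μ) * a ^ 2 + μ * b ^ 2 * ((x * (x - 1) + y ^ 2) * a * b) =
      a * ((1 - μ) * a ^ 3 * (x ^ 2 + y ^ 2) + μ * b ^ 3 * (x * (x - 1) + y ^ 2)) := by
    linear_combination (-(1 - μ) * a ^ 2) * h1
  have hB : (1 - μ) * a ^ 2 * ((x * (x - 1) + y ^ 2) * a * b) + μ * b ^ 2 =
      b * ((1 - μ) * a ^ 3 * (x * (x - 1) + y ^ 2) + μ * b ^ 3 * ((x - 1) ^ 2 + y ^ 2)) := by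
    linear_combination (-μ * b ^ 2) * h2
  rw [hA, hB]
  have key : ∀ u v : ℝ, (1 - μ) * (a ^ 3 * (u * u + v * v)
      - 3 * a ^ 5 * (x * u + y * v) * (x * u + y * v))
      + μ * (b ^ 3 * (u * u + v * v)
      - 3 * b ^ 5 * ((x - 1) * u + y * v) * ((x - 1) * u + y * v))
      = (1 - μ) * a ^ 5 * ((x * v - y * u) ^ 2 - 2 * (x * u + y * v) ^ 2)
      + μ * b ^ 5 * (((x - 1) * v - y * u) ^ 2 - 2 * ((x - 1) * u + y * v) ^ 2) := by
    intro u v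
    rw [ha3, hb3]; ring
  rw [key]
  ring

/-- The positivity of the curvature for equal masses, after division by `a * b`:
here `z = a / b + b / a`, and the hypothesis `hU` is the energy condition. -/
theorem equal_mass_inequality {z C : ℝ} (hz : 2 ≤ z) (hC : -1 ≤ C)
    (hU : 16 < (z + 2) * (z - 2 * C)) :
    0 < z ^ 3 - z ^ 2 - 2 * z - 1 + 2 * (z - 1) * C + 3 * C ^ 2 := by
  obtain ⟨d, rfl⟩ : ∃ d, C = -1 + d := ⟨C + 1, by ring⟩
  have hd : 0 ≤ d := by linarith
  have hz2 : 2 < z := by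
    rcases hz.lt_or_eq with h | h
    · exact h
    · subst h; nlinarith
  have hexp : z ^ 3 - z ^ 2 - 2 * z - 1 + 2 * (z - 1) * (-1 + d) + 3 * (-1 + d) ^ 2
      = (z - 1) * (z - 2) * (z + 2) + (2 * z - 8) * d + 3 * d ^ 2 := by ring
  rw [hexp]
  have h1 : 0 < (z - 1) * (z - 2) * (z + 2) := by
    have : 0 < z - 2 := by linarith
    have : 0 < z - 1 := by linarith
    positivity
  rcases le_total 4 z with h | h
  · have : 0 ≤ (2 * z - 8) * d := mul_nonneg (by linarith) hd
    positivity
  · have h2 : 2 * d * (z + 2) ≤ (z - 2) * (z + 6) := by nlinarith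
    have h3 : (4 - z) * (2 * d * (z + 2)) ≤ (4 - z) * ((z - 2) * (z + 6)) :=
      mul_le_mul_of_nonneg_left h2 (by linarith)
    have h4 : 0 < (z - 2) * ((z - 1) * (z + 2) ^ 2 + z ^ 2 + 2 * z - 24) :=
      mul_pos (by linarith) (by nlinarith)
    have h5 : 0 < ((z - 1) * (z - 2) * (z + 2) + (2 * z - 8) * d) * (z + 2) := by nlinarith
    have h6 := pos_of_mul_pos_left h5 (by linarith)
    positivity

theorem curvNumerator_half_pos {a b C : ℝ} (ha : 0 < a) (hb : 0 < b) (hC : -1 ≤ C)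
    (hlaw : a ^ 2 * b ^ 2 = a ^ 2 + b ^ 2 - 2 * a * b * C) (hU : 4 < a + b) :
    0 < curvNumerator a b (1 / 2 * a ^ 2) (1 / 2 * b ^ 2) C := by
  obtain ⟨z, hz⟩ : ∃ z, a ^ 2 + b ^ 2 = z * (a * b) :=
    ⟨(a ^ 2 + b ^ 2) / (a * b), by field_simp⟩
  have hab : 0 < a * b := by positivity
  have hz2 : 2 ≤ z := by
    by_contra h
    nlinarith [sq_nonneg (a - b)]
  have hP : a * b = z - 2 * C :=
    mul_left_cancel₀ hab.ne' (by linear_combination hlaw + hz)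
  have h16 : 16 < (z + 2) * (z - 2 * C) := by
    rw [← hP]; nlinarith
  have key := equal_mass_inequality hz2 hC h16
  have : curvNumerator a b (1 / 2 * a ^ 2) (1 / 2 * b ^ 2) C = 1 / 8 * (a * b) ^ 3 * (a + b) *
      (z ^ 3 - z ^ 2 - 2 * z - 1 + 2 * (z - 1) * C + 3 * C ^ 2) := by
    have e : z = (a ^ 2 + b ^ 2) / (a * b) := by field_simp; linarith
    rw [e, curvNumerator]
    field_simp
    ring
  rw [this]
  positivity

theorem inv_norm_sub_pos {P q : Plane} (h : q ≠ P) : 0 < ‖q - P‖⁻¹ :=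
  inv_pos.2 (norm_pos_iff.2 (sub_ne_zero.2 h))

theorem criticalEnergy_half : criticalEnergy (1 / 2) = -2 := by
  rw [criticalEnergy_eq (by norm_num) (by norm_num),
    show (1 / 2 * (1 - 1 / 2) : ℝ) = (1 / 2) ^ 2 by norm_num, Real.sqrt_sq (by norm_num)]
  norm_num

/-- For equal masses the level curves below the critical energy are strictly convex. -/
theorem potentialHess_levelTangent_pos {q : Plane} (hE : q ≠ earth) (hM : q ≠ moon)
    (hU : potential (1 / 2) q < -2) :
    0 < potentialHess (1 / 2) (levelTangent (1 / 2) q) (levelTangent (1 / 2) q) q := by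
  rw [potentialHess_levelTangent _ hE hM, show (1 - 1 / 2 : ℝ) = 1 / 2 by norm_num]
  refine curvNumerator_half_pos (inv_norm_sub_pos hE) (inv_norm_sub_pos hM)
    (neg_one_le_cosCenters hE hM) (law_of_cosines hE hM) ?_
  rw [potential_eq] at hU
  linarith

theorem levelCurvature_neg {μ : ℝ} {q : Plane} (hE : q ≠ earth) (hM : q ≠ moon)
    (h : potentialHess μ (levelTangent μ q) (levelTangent μ q) q < 0) :
    levelCurvature (potential μ) q < 0 := by
  rw [levelCurvature_potential _ hE hM]
  have := norm_pos_iff.2 (levelTangent_ne_zero h.ne)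
  exact div_neg_of_neg_of_pos h (by positivity)

theorem levelCurvature_half_pos {q : Plane} (hE : q ≠ earth) (hM : q ≠ moon)
    (hU : potential (1 / 2) q < -2) : 0 < levelCurvature (potential (1 / 2)) q := by
  have h := potentialHess_levelTangent_pos hE hM hU
  rw [levelCurvature_potential _ hE hM]
  have := norm_pos_iff.2 (levelTangent_ne_zero h.ne')
  positivity

/-! ### Negative curvature near the saddle point -/

/-- The cofactor of `η ^ 3` in the curvature numerator along the critical level curve, where `e`
and `m` are the square roots of the masses and `η` parametrizes the curve. -/
def criticalCofactor (e m η : ℝ) : ℝ :=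
  let α := 1 + m * η
  let β := 1 - e * η
  let d := e - m
  let s := e + m
  let u := α * β
  let g := 1 - d * η - e * m * η ^ 2 / 2
  α ^ 3 * m * (u ^ 2 * (-4 * d + d ^ 2 * η) + 2 * u * (2 - d * η) * β ^ 2 * s * g
      + 3 * η * β ^ 4 * s ^ 2 * g ^ 2 + 4 * (e * (1 + β) * (1 + β ^ 2)) * u ^ 2
      - 2 * β ^ 4 * u * (e * m * η))
    + β ^ 3 * e * (u ^ 2 * (-4 * d + d ^ 2 * η) - 2 * u * (2 - d * η) * α ^ 2 * s * g
      + 3 * η * α ^ 4 * s ^ 2 * g ^ 2 - 4 * (m * (1 + α) * (1 + α ^ 2)) * u ^ 2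
      - 2 * α ^ 4 * u * (e * m * η))

theorem criticalCofactor_zero (e m : ℝ) : criticalCofactor e m 0 = 8 * (m ^ 2 - e ^ 2) := by
  simp only [criticalCofactor]; ring

theorem continuous_criticalCofactor (e m : ℝ) : Continuous (criticalCofactor e m) := by
  unfold criticalCofactor; fun_prop

theorem critical_law {e m α β C : ℝ} (he : 0 < e) (hm : 0 < m)
    (h : ((e + m) * α / e) ^ 2 * ((e + m) * β / m) ^ 2 = ((e + m) * α / e) ^ 2
      + ((e + m) * β / m) ^ 2 - 2 * ((e + m) * α / e) * ((e + m) * β / m) * C) :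
    (e + m) ^ 2 * (α * β) ^ 2 = (m * α) ^ 2 + (e * β) ^ 2 - 2 * (e * m) * (α * β) * C := by
  have hs : (e + m) ^ 2 ≠ 0 := by positivity
  refine mul_left_cancel₀ hs ?_
  field_simp at h
  linear_combination (e + m) ^ 2 * h

/-- The law of cosines on the critical level curve, solved for the angle. -/
theorem critical_angle {e m η C : ℝ} (he : 0 < e) (hm : 0 < m)
    (hlaw : (e + m) ^ 2 * ((1 + m * η) * (1 - e * η)) ^ 2 =
      (m * (1 + m * η)) ^ 2 + (e * (1 - e * η)) ^ 2
        - 2 * (e * m) * ((1 + m * η) * (1 - e * η)) * C) :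
    (1 + m * η) * (1 - e * η) * C = (e + m) ^ 2 * η ^ 2 *
      (1 - (e - m) * η - e * m * η ^ 2 / 2) - (1 + m * η) * (1 - e * η) := by
  refine mul_left_cancel₀ (a := 2 * (e * m)) (by positivity) ?_
  linear_combination hlaw

theorem curvNumerator_critical {e m η C : ℝ} (he : 0 < e) (hm : 0 < m)
    (hC : (1 + m * η) * (1 - e * η) * C = (e + m) ^ 2 * η ^ 2 *
      (1 - (e - m) * η - e * m * η ^ 2 / 2) - (1 + m * η) * (1 - e * η)) :
    ((1 + m * η) * (1 - e * η)) ^ 2 * (e * m) *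
      curvNumerator ((e + m) * (1 + m * η) / e) ((e + m) * (1 - e * η) / m)
        ((e + m) ^ 2 * (1 + m * η) ^ 2) ((e + m) ^ 2 * (1 - e * η) ^ 2) C =
      (e + m) ^ 9 * η ^ 3 * criticalCofactor e m η := by
  have h : ∀ α β w : ℝ, α * β * C = w → (α * β) ^ 2 * (e * m) *
      curvNumerator ((e + m) * α / e) ((e + m) * β / m)
        ((e + m) ^ 2 * α ^ 2) ((e + m) ^ 2 * β ^ 2) C =
      (e + m) ^ 7 * (α ^ 3 * m * ((α * β * α ^ 2 + β ^ 2 * w) ^ 2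
        - 2 * β ^ 4 * ((α * β) ^ 2 - w ^ 2)) + β ^ 3 * e * ((α ^ 2 * w + α * β * β ^ 2) ^ 2
        - 2 * α ^ 4 * ((α * β) ^ 2 - w ^ 2))) := by
    rintro α β w rfl
    rw [curvNumerator]
    field_simp
  rw [h _ _ _ hC]
  simp only [criticalCofactor]
  ring

theorem add_le_of_inv_bounds {a b e m s X Y : ℝ} (he : 0 ≤ e) (ha : 0 ≤ a)
    (hX : 0 ≤ X) (hY : 0 ≤ Y) (h1 : a ^ 2 * X = 1) (h2 : b ^ 2 * Y = 1) (hae : a * e ≤ s)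
    (hbm : s ≤ b * m) : Y * s ^ 2 + e ^ 2 ≤ X * s ^ 2 + m ^ 2 := by
  have hs : 0 ≤ s := (mul_nonneg ha he).trans hae
  have e1 : (a * e) ^ 2 ≤ s ^ 2 := pow_le_pow_left₀ (mul_nonneg ha he) hae 2
  have e2 : s ^ 2 ≤ (b * m) ^ 2 := pow_le_pow_left₀ hs hbm 2
  have e3 := mul_le_mul_of_nonneg_left e1 hX
  have e4 := mul_le_mul_of_nonneg_left e2 hY
  linear_combination e3 + e4 + m ^ 2 * h2 - e ^ 2 * h1

theorem saddleAbscissa_eq {μ : ℝ} (h0 : 0 < μ) (h1 : μ < 1) :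
    saddleAbscissa μ = √(1 - μ) / (√(1 - μ) + √μ) := by
  have hx0 : 0 < √μ := by positivity
  have hy0 : 0 < √(1 - μ) := Real.sqrt_pos.2 (by linarith)
  have hx2 : √μ ^ 2 = μ := Real.sq_sqrt h0.le
  have hy2 : √(1 - μ) ^ 2 = 1 - μ := Real.sq_sqrt (by linarith)
  rw [saddleAbscissa, Real.sqrt_mul h0.le]
  split_ifs with h
  · have : √(1 - μ) = √μ := by rw [h]; norm_num
    rw [this]; field_simp
    norm_num
  · have hne : 1 - 2 * μ ≠ 0 := fun h' => h (by linarith)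
    rw [div_eq_div_iff hne (by positivity)]
    nlinarith

theorem saddle_zero (μ : ℝ) : saddle μ 0 = saddleAbscissa μ := by simp [saddle]
theorem saddle_one (μ : ℝ) : saddle μ 1 = 0 := by simp [saddle]

theorem saddleAbscissa_pos {μ : ℝ} (h0 : 0 < μ) (h1 : μ < 1) : 0 < saddleAbscissa μ := by
  rw [saddleAbscissa_eq h0 h1]
  have : 0 < √μ := by positivity
  have : 0 < √(1 - μ) := Real.sqrt_pos.2 (by linarith)
  positivity

theorem saddleAbscissa_lt_one {μ : ℝ} (h0 : 0 < μ) (h1 : μ < 1) : saddleAbscissa μ < 1 := by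
  rw [saddleAbscissa_eq h0 h1]
  have : 0 < √μ := by positivity
  have : 0 < √(1 - μ) := Real.sqrt_pos.2 (by linarith)
  rw [div_lt_one (by positivity)]
  linarith

theorem potential_saddle (μ : ℝ) : potential μ (saddle μ) = criticalEnergy μ := by
  simp [criticalEnergy, hamiltonian]

theorem saddle_ne_earth {μ : ℝ} (h0 : 0 < μ) (h1 : μ < 1) : saddle μ ≠ earth := fun h => by
  have := congrArg (· 0) h
  simp only [saddle_zero, earth_zero] at this
  linarith [saddleAbscissa_pos h0 h1]

theorem saddle_ne_moon {μ : ℝ} (h0 : 0 < μ) (h1 : μ < 1) : saddle μ ≠ moon := fun h => by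
  have := congrArg (· 0) h
  simp only [saddle_zero, moon_zero] at this
  linarith [saddleAbscissa_lt_one h0 h1]

/-- On the critical level curve, to the left of the saddle point and close to it, the curvature
numerator is negative. -/
theorem exists_potentialHess_levelTangent_neg {μ : ℝ} (h0 : 0 < μ) (h1 : μ < 1 / 2) :
    ∃ δ : ℝ, 0 < δ ∧ ∀ q : Plane, potential μ q = criticalEnergy μ →
      q 0 < saddleAbscissa μ → dist q (saddle μ) < δ → q ≠ earth ∧ q ≠ moon ∧
      potentialHess μ (levelTangent μ q) (levelTangent μ q) q < 0 := by
  obtain ⟨e, he⟩ : ∃ e, e = √(1 - μ) := ⟨_, rfl⟩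
  obtain ⟨m, hm⟩ : ∃ m, m = √μ := ⟨_, rfl⟩
  have he0 : 0 < e := by rw [he]; exact Real.sqrt_pos.2 (by linarith)
  have hm0 : 0 < m := by rw [hm]; exact Real.sqrt_pos.2 h0
  have he2 : e ^ 2 = 1 - μ := by rw [he]; exact Real.sq_sqrt (by linarith)
  have hm2 : m ^ 2 = μ := by rw [hm]; exact Real.sq_sqrt h0.le
  have hme : m ^ 2 - e ^ 2 < 0 := by linarith
  have hl : saddleAbscissa μ = e / (e + m) := by rw [saddleAbscissa_eq h0 (by linarith), he, hm]
  have hcJ : criticalEnergy μ = -(e + m) ^ 2 := by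
    rw [criticalEnergy_eq h0 (by linarith), Real.sqrt_mul h0.le, ← he, ← hm]
    nlinarith
  -- The parameter of the critical level curve: `|q - E| = e / ((e + m) (1 + m η))`.
  set η : Plane → ℝ := fun q => (e * ‖q - earth‖⁻¹ / (e + m) - 1) / m with hη
  have hSE := saddle_ne_earth h0 (show μ < 1 by linarith)
  have hSM := saddle_ne_moon h0 (show μ < 1 by linarith)
  have hη0 : η (saddle μ) = 0 := by
    have : ‖saddle μ - earth‖ = e / (e + m) := by
      have h3 : 0 ≤ e / (e + m) := by positivity
      rw [← hl, EuclideanSpace.norm_eq, Fin.sum_univ_two]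
      simp only [PiLp.sub_apply, saddle_zero, saddle_one, earth_zero, earth_one]
      rw [hl]
      simp only [sub_zero, Real.norm_eq_abs, sq_abs]
      simp only [ne_eq, OfNat.ofNat_ne_zero, not_false_eq_true, zero_pow, add_zero,
        Real.sqrt_sq h3]
    rw [hη]; simp only [this]
    field_simp
    ring
  have hηc : ContinuousAt η (saddle μ) := by
    have := (hasFDerivAt_inv_norm_sub hSE).continuousAt
    rw [hη]
    fun_prop
  have ev1 : ∀ᶠ q in 𝓝 (saddle μ), criticalCofactor e m (η q) < 0 := by
    have hc : ContinuousAt (fun q => criticalCofactor e m (η q)) (saddle μ) :=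
      (continuous_criticalCofactor e m).continuousAt.comp hηc
    refine hc.eventually_lt continuousAt_const ?_
    rw [hη0, criticalCofactor_zero]; linarith
  obtain ⟨δ, hδ, hev⟩ := Metric.eventually_nhds_iff.1
    (ev1.and (eventually_ne_centers hSE hSM))
  refine ⟨δ, hδ, fun q hU hx hd => ?_⟩
  obtain ⟨hQ, hE, hM⟩ := hev hd
  refine ⟨hE, hM, ?_⟩
  have ha := inv_norm_sub_pos hE
  have hb := inv_norm_sub_pos hM
  have hi1 : ‖q - earth‖⁻¹ = (e + m) * (1 + m * η q) / e := by
    rw [hη]; field_simp; ring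
  have hi2 : ‖q - moon‖⁻¹ = (e + m) * (1 - e * η q) / m := by
    have h4 : e ^ 2 * ‖q - earth‖⁻¹ + m ^ 2 * ‖q - moon‖⁻¹ = (e + m) ^ 2 := by
      rw [potential_eq, hcJ] at hU
      rw [he2, hm2]; linarith
    rw [hi1] at h4
    have h5 : e ^ 2 * ((e + m) * (1 + m * η q) / e) = e * ((e + m) * (1 + m * η q)) := by
      field_simp
    rw [h5] at h4
    rw [eq_div_iff hm0.ne']
    refine mul_left_cancel₀ hm0.ne' ?_
    linear_combination h4
  have hα : 0 < 1 + m * η q := by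
    rw [hi1] at ha
    by_contra h
    have : (e + m) * (1 + m * η q) / e ≤ 0 :=
      div_nonpos_of_nonpos_of_nonneg (mul_nonpos_of_nonneg_of_nonpos (by positivity)
        (not_lt.1 h)) he0.le
    linarith
  have hβ : 0 < 1 - e * η q := by
    rw [hi2] at hb
    by_contra h
    have : (e + m) * (1 - e * η q) / m ≤ 0 :=
      div_nonpos_of_nonpos_of_nonneg (mul_nonpos_of_nonneg_of_nonpos (by positivity)
        (not_lt.1 h)) hm0.le
    linarith
  have hlaw := law_of_cosines hE hM
  -- The points to the left of the saddle point are those with positive parameter.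
  have hηpos : 0 < η q := by
    by_contra hneg
    have hneg : η q ≤ 0 := not_lt.1 hneg
    have g1 := inv_norm_sq_mul hE
    have g2 := inv_norm_sq_mul hM
    simp only [earth_zero, earth_one, moon_zero, moon_one, sub_zero] at g1 g2
    have b1 : ‖q - earth‖⁻¹ * e ≤ e + m := by
      rw [hi1, div_mul_cancel₀ _ he0.ne']
      have : (e + m) * (m * η q) ≤ 0 := mul_nonpos_of_nonneg_of_nonpos (by positivity)
        (mul_nonpos_of_nonneg_of_nonpos hm0.le hneg)
      linarith
    have b2 : e + m ≤ ‖q - moon‖⁻¹ * m := by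
      rw [hi2, div_mul_cancel₀ _ hm0.ne']
      have : (e + m) * (e * η q) ≤ 0 := mul_nonpos_of_nonneg_of_nonpos (by positivity)
        (mul_nonpos_of_nonneg_of_nonpos he0.le hneg)
      linarith
    have c := add_le_of_inv_bounds he0.le ha.le (by positivity) (by positivity) g1 g2 b1 b2
    rw [hl, lt_div_iff₀ (by positivity)] at hx
    nlinarith
  rw [potentialHess_levelTangent μ hE hM, ← he2, ← hm2, hi1, hi2]
  have eA : e ^ 2 * ((e + m) * (1 + m * η q) / e) ^ 2 = (e + m) ^ 2 * (1 + m * η q) ^ 2 := by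
    field_simp
  have eB : m ^ 2 * ((e + m) * (1 - e * η q) / m) ^ 2 = (e + m) ^ 2 * (1 - e * η q) ^ 2 := by
    field_simp
  rw [eA, eB]
  have key := curvNumerator_critical (η := η q) (C := cosCenters q) he0 hm0
    (critical_angle he0 hm0 ?_)
  · have hr : (e + m) ^ 9 * η q ^ 3 * criticalCofactor e m (η q) < 0 :=
      mul_neg_of_pos_of_neg (by positivity) hQ
    rw [← key] at hr
    exact (mul_neg_iff.1 hr).elim (fun h => h.2) fun h => absurd h.1 (not_lt.2 (by positivity))
  · exact critical_law he0 hm0 (by rw [← hi1, ← hi2]; exact hlaw)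

/-! ### Monotonicity of the potential and the component around a center -/

theorem earth_eq_zero : earth = 0 := by
  ext i; fin_cases i <;> simp [earth]

theorem ne_moon_of_lt_one {q : Plane} (h : q 0 < 1) : q ≠ moon := fun h' => by
  rw [h', moon_zero] at h; exact lt_irrefl _ h

/-- To the left of the saddle point the center at the origin dominates. -/
theorem mul_norm_sq_le_of_le_saddleAbscissa {μ : ℝ} (h0 : 0 < μ) (h1 : μ ≤ 1 / 2) {q : Plane}
    (hq : q 0 ≤ saddleAbscissa μ) : μ * ‖q‖ ^ 2 ≤ (1 - μ) * ‖q - moon‖ ^ 2 ∧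
      (q 0 < saddleAbscissa μ → μ * ‖q‖ ^ 2 < (1 - μ) * ‖q - moon‖ ^ 2) := by
  have hl1 := saddleAbscissa_lt_one h0 (show μ < 1 by linarith)
  obtain ⟨e, he⟩ : ∃ e, e = √(1 - μ) := ⟨_, rfl⟩
  obtain ⟨m, hm⟩ : ∃ m, m = √μ := ⟨_, rfl⟩
  have hm0 : 0 < m := by rw [hm]; exact Real.sqrt_pos.2 h0
  have hme : m ≤ e := by rw [he, hm]; exact Real.sqrt_le_sqrt (by linarith)
  have he2 : e ^ 2 = 1 - μ := by rw [he]; exact Real.sq_sqrt (by linarith)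
  have hm2 : m ^ 2 = μ := by rw [hm]; exact Real.sq_sqrt h0.le
  have hx1 : q 0 < 1 := hq.trans_lt hl1
  rw [saddleAbscissa_eq h0 (by linarith), ← he, ← hm, le_div_iff₀ (by linarith)] at hq
  have hlt : q 0 < saddleAbscissa μ → q 0 * (e + m) < e := fun h => by
    rwa [saddleAbscissa_eq h0 (by linarith), ← he, ← hm, lt_div_iff₀ (by linarith)] at h
  rw [norm_sq_eq, norm_sq_eq, ← he2]
  simp only [PiLp.sub_apply, moon_zero, moon_one, sub_zero]
  have f1 : 0 ≤ e - q 0 * (e + m) := by linarith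
  have f2 : 0 < e - (e - m) * q 0 := by nlinarith
  have f3 : (m ^ 2 - e ^ 2) * q 1 ^ 2 ≤ 0 :=
    mul_nonpos_of_nonpos_of_nonneg (by nlinarith) (sq_nonneg _)
  rw [hm2] at f3
  refine ⟨?_, fun h => ?_⟩
  · linear_combination mul_nonneg f1 f2.le + f3 - q 0 ^ 2 * hm2
  · linear_combination mul_pos (sub_pos.2 (hlt h)) f2 + f3 - q 0 ^ 2 * hm2

/-- The potential increases along the rays from the origin up to the abscissa of the saddle
point. -/
theorem potential_smul_lt {μ : ℝ} (h0 : 0 < μ) (h1 : μ ≤ 1 / 2) {q : Plane} (hE : q ≠ earth)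
    (hq : q 0 ≤ saddleAbscissa μ) {t : ℝ} (ht0 : 0 < t) (ht1 : t < 1) :
    potential μ (t • q) < potential μ q := by
  have hl0 := saddleAbscissa_pos h0 (show μ < 1 by linarith)
  have hl1 := saddleAbscissa_lt_one h0 (show μ < 1 by linarith)
  have htq : (t • q) 0 < saddleAbscissa μ := by
    simp only [PiLp.smul_apply, smul_eq_mul]
    rcases le_total (q 0) 0 with h | h <;> nlinarith
  have hM := ne_moon_of_lt_one (hq.trans_lt hl1)
  have hM' := ne_moon_of_lt_one (htq.trans hl1)
  have d1 := (mul_norm_sq_le_of_le_saddleAbscissa h0 h1 hq).1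
  have d2 := (mul_norm_sq_le_of_le_saddleAbscissa h0 h1 htq.le).2 htq
  have hρ : 0 < ‖q - moon‖ := norm_pos_iff.2 (sub_ne_zero.2 hM)
  have hρt : 0 < ‖t • q - moon‖ := norm_pos_iff.2 (sub_ne_zero.2 hM')
  have hr : 0 < ‖q‖ := norm_pos_iff.2 (by rwa [← earth_eq_zero])
  have hn : ‖t • q‖ = t * ‖q‖ := by rw [norm_smul, Real.norm_of_nonneg ht0.le]
  have htri : ‖t • q - moon‖ ≤ ‖q - moon‖ + (1 - t) * ‖q‖ := by
    have : t • q - moon = (q - moon) - (1 - t) • q := by module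
    rw [this]
    refine (norm_sub_le _ _).trans_eq ?_
    rw [norm_smul, Real.norm_of_nonneg (by linarith)]
  rw [hn] at d2
  simp only [potential, earth_eq_zero, sub_zero, hn]
  generalize ‖q - moon‖ = ρ at *
  generalize ‖t • q - moon‖ = ρt at *
  generalize ‖q‖ = r at *
  have hμ1 : 0 < 1 - μ := by linarith
  have hprod : μ * (r * (t * r)) < (1 - μ) * (ρ * ρt) := by
    refine lt_of_pow_lt_pow_left₀ 2 (by positivity) ?_
    calc (μ * (r * (t * r))) ^ 2 = (μ * r ^ 2) * (μ * (t * r) ^ 2) := by ring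
      _ ≤ ((1 - μ) * ρ ^ 2) * (μ * (t * r) ^ 2) := by gcongr
      _ < ((1 - μ) * ρ ^ 2) * ((1 - μ) * ρt ^ 2) := by gcongr
      _ = _ := by ring
  have e1 : -(1 - μ) / (t * r) = -(1 - μ) / r - (1 - μ) * (1 - t) / (t * r) := by
    field_simp; ring
  have e2 : μ / ρt = μ / ρ - μ * (ρt - ρ) / (ρ * ρt) := by
    field_simp; ring
  have e3 : μ * (ρt - ρ) / (ρ * ρt) ≤ μ * ((1 - t) * r) / (ρ * ρt) := by
    gcongr; linarith
  have e4 : μ * ((1 - t) * r) / (ρ * ρt) < (1 - μ) * (1 - t) / (t * r) := by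
    rw [div_lt_div_iff₀ (by positivity) (by positivity)]
    have : 0 < 1 - t := by linarith
    nlinarith [mul_lt_mul_of_pos_left hprod this]
  rw [e1, e2]
  linarith

theorem norm_sub_le_of_vertical {P q q' : Plane} (h0 : q 0 = q' 0) (hP : P 1 = 0)
    (h1 : q 1 ^ 2 ≤ q' 1 ^ 2) : ‖q - P‖ ≤ ‖q' - P‖ := by
  refine le_of_sq_le_sq ?_ (norm_nonneg _)
  rw [norm_sq_eq, norm_sq_eq]
  simp only [PiLp.sub_apply, h0, hP, sub_zero]
  linarith

theorem norm_sub_lt_of_vertical {P q q' : Plane} (h0 : q 0 = q' 0) (hP : P 1 = 0)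
    (h1 : q 1 ^ 2 < q' 1 ^ 2) : ‖q - P‖ < ‖q' - P‖ := by
  refine lt_of_pow_lt_pow_left₀ 2 (norm_nonneg _) ?_
  rw [norm_sq_eq, norm_sq_eq]
  simp only [PiLp.sub_apply, h0, hP, sub_zero]
  linarith

/-- The potential increases with the distance from the axis of the centers. -/
theorem potential_le_of_vertical {μ : ℝ} (hμ0 : 0 < μ) (hμ1 : μ < 1) {q q' : Plane}
    (hE : q ≠ earth) (hM : q ≠ moon) (h0 : q 0 = q' 0) (h1 : q 1 ^ 2 ≤ q' 1 ^ 2) :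
    potential μ q ≤ potential μ q' := by
  have a := norm_sub_le_of_vertical h0 earth_one h1
  have b := norm_sub_le_of_vertical h0 moon_one h1
  have a0 : 0 < ‖q - earth‖ := norm_pos_iff.2 (sub_ne_zero.2 hE)
  have b0 : 0 < ‖q - moon‖ := norm_pos_iff.2 (sub_ne_zero.2 hM)
  rw [potential_eq, potential_eq, neg_le_neg_iff]
  have : 0 < 1 - μ := by linarith
  gcongr

theorem potential_lt_of_vertical {μ : ℝ} (hμ0 : 0 < μ) (hμ1 : μ < 1) {q q' : Plane}
    (hE : q ≠ earth) (hM : q ≠ moon) (h0 : q 0 = q' 0) (h1 : q 1 ^ 2 < q' 1 ^ 2) :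
    potential μ q < potential μ q' := by
  have a := norm_sub_lt_of_vertical h0 earth_one h1
  have b := norm_sub_lt_of_vertical h0 moon_one h1
  have a0 : 0 < ‖q - earth‖ := norm_pos_iff.2 (sub_ne_zero.2 hE)
  have b0 : 0 < ‖q - moon‖ := norm_pos_iff.2 (sub_ne_zero.2 hM)
  rw [potential_eq, potential_eq, neg_lt_neg_iff]
  have : 0 < 1 - μ := by linarith
  gcongr

/-- Above the saddle point the potential is at least the critical energy. -/
theorem criticalEnergy_le_potential {μ : ℝ} (hμ0 : 0 < μ) (hμ1 : μ < 1) {q : Plane}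
    (h0 : q 0 = saddleAbscissa μ) : criticalEnergy μ ≤ potential μ q := by
  rw [← potential_saddle]
  refine potential_le_of_vertical hμ0 hμ1 (saddle_ne_earth hμ0 hμ1) (saddle_ne_moon hμ0 hμ1)
    (by rw [saddle_zero, h0]) ?_
  rw [saddle_one]
  simpa using sq_nonneg (q 1)

theorem continuousAt_potential (μ : ℝ) {q : Plane} (hE : q ≠ earth) (hM : q ≠ moon) :
    ContinuousAt (potential μ) q := by
  obtain ⟨L, h, -⟩ := hasFDerivAt_potential μ hE hM
  exact h.continuousAt

/-- To the left of the saddle point the energy surface belongs to the component around the origin: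
every point can be moved into the origin along a ray, adjusting the length of the momentum. -/
theorem mem_primaryComponent_earth {μ c : ℝ} (h0 : 0 < μ) (h1 : μ ≤ 1 / 2) {q p : Plane}
    (hE : q ≠ earth) (hq : q 0 < saddleAbscissa μ) (hc : hamiltonian μ q p = c) :
    (q, p) ∈ primaryComponent μ c earth := by
  have hl0 := saddleAbscissa_pos h0 (show μ < 1 by linarith)
  have hl1 := saddleAbscissa_lt_one h0 (show μ < 1 by linarith)
  have hmem : (q, p) ∈ energySurface μ c := ⟨hE, ne_moon_of_lt_one (hq.trans hl1), hc⟩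
  refine ⟨hmem, ?_⟩
  obtain ⟨d, hd, hpd⟩ : ∃ d : Plane, ‖d‖ = 1 ∧ ‖p‖ • d = p := by
    by_cases hp : p = 0
    · exact ⟨EuclideanSpace.single 0 1, by simp, by simp [hp]⟩
    · have : ‖p‖ ≠ 0 := norm_ne_zero_iff.2 hp
      exact ⟨‖p‖⁻¹ • p, by rw [norm_smul]; simp [this], by rw [smul_smul]; simp [this]⟩
  have hq0 : q ≠ 0 := by rwa [← earth_eq_zero]
  have hne : ∀ t ∈ Set.Ioc (0 : ℝ) 1, t • q ≠ earth ∧ t • q ≠ moon := by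
    intro t ht
    refine ⟨by rw [earth_eq_zero]; exact smul_ne_zero ht.1.ne' hq0, ne_moon_of_lt_one ?_⟩
    simp only [PiLp.smul_apply, smul_eq_mul]
    have := hq.trans hl1
    rcases le_total (q 0) 0 with h | h <;> nlinarith [ht.1, ht.2]
  have hle : ∀ t ∈ Set.Ioc (0 : ℝ) 1, potential μ (t • q) ≤ c := by
    intro t ht
    have hqc : potential μ q ≤ c := by
      rw [← hc, hamiltonian]; have := sq_nonneg ‖p‖; linarith
    rcases ht.2.lt_or_eq with h | h
    · exact (potential_smul_lt h0 h1 hE hq.le ht.1 h).le.trans hqc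
    · rw [h, one_smul]; exact hqc
  set γ : ℝ → Plane × Plane := fun t => (t • q, √(2 * (c - potential μ (t • q))) • d) with hγ
  have hγc : ContinuousOn γ (Set.Ioc 0 1) := by
    have hpc : ContinuousOn (fun t : ℝ => potential μ (t • q)) (Set.Ioc 0 1) := fun t ht =>
      (ContinuousAt.comp (f := fun t : ℝ => t • q) (continuousAt_potential μ (hne t ht).1
        (hne t ht).2) (by fun_prop)).continuousWithinAt
    exact ContinuousOn.prodMk (by fun_prop) (by fun_prop)
  have hγs : γ '' Set.Ioc 0 1 ⊆ energySurface μ c := by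
    rintro _ ⟨t, ht, rfl⟩
    refine ⟨(hne t ht).1, (hne t ht).2, ?_⟩
    have := hle t ht
    simp only [hγ, hamiltonian, norm_smul, hd, mul_one, Real.norm_eq_abs, sq_abs]
    rw [Real.sq_sqrt (by linarith)]
    ring
  have hγ1 : γ 1 = (q, p) := by
    have : 2 * (c - potential μ q) = ‖p‖ ^ 2 := by rw [← hc, hamiltonian]; ring
    simp only [hγ, one_smul, this, Real.sqrt_sq (norm_nonneg _), hpd]
  have hsub : γ '' Set.Ioc 0 1 ⊆ connectedComponentIn (energySurface μ c) (q, p) :=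
    (isPreconnected_Ioc.image γ hγc).subset_connectedComponentIn
      ⟨1, by simp, hγ1⟩ hγs
  have hlim : Tendsto (fun t : ℝ => t • q) (𝓝[>] 0) (𝓝 earth) := by
    have : Continuous fun t : ℝ => t • q := by fun_prop
    have h := this.tendsto 0
    rw [zero_smul, ← earth_eq_zero] at h
    exact h.mono_left nhdsWithin_le_nhds
  refine mem_closure_of_tendsto hlim ?_
  filter_upwards [Ioc_mem_nhdsGT (zero_lt_one' ℝ)] with t ht
  exact ⟨γ t, hsub ⟨t, ht, rfl⟩, rfl⟩

/-- Below the critical energy the component around the origin lies to the left of the saddle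
point. -/
theorem mem_primaryComponent_earth_iff {μ c : ℝ} (h0 : 0 < μ) (h1 : μ ≤ 1 / 2)
    (hc : c < criticalEnergy μ) {q p : Plane} :
    (q, p) ∈ primaryComponent μ c earth ↔
      q ≠ earth ∧ q 0 < saddleAbscissa μ ∧ hamiltonian μ q p = c := by
  refine ⟨fun h => ?_, fun h => mem_primaryComponent_earth h0 h1 h.1 h.2.1 h.2.2⟩
  obtain ⟨hs, hcl⟩ := h
  refine ⟨hs.1, ?_, hs.2.2⟩
  by_contra hge
  have hne : ∀ z ∈ energySurface μ c, z.1 0 ≠ saddleAbscissa μ := by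
    rintro z ⟨-, -, hz⟩ h
    have := criticalEnergy_le_potential h0 (by linarith) h
    rw [hamiltonian] at hz
    have := sq_nonneg ‖z.2‖
    linarith
  have hgt : ∀ z ∈ connectedComponentIn (energySurface μ c) (q, p), saddleAbscissa μ < z.1 0 := by
    intro z hz
    by_contra hlt
    have himg := (isPreconnected_connectedComponentIn (F := energySurface μ c)
      (x := (q, p))).image (fun z : Plane × Plane => z.1 0) (by fun_prop)
    obtain ⟨w, hw, hw'⟩ := himg.ordConnected.out ⟨z, hz, rfl⟩
      ⟨(q, p), mem_connectedComponentIn hs, rfl⟩ ⟨not_lt.1 hlt, not_lt.1 hge⟩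
    exact hne w (connectedComponentIn_subset _ _ hw) hw'
  have hclosed : IsClosed {x : Plane | saddleAbscissa μ ≤ x 0} :=
    isClosed_le continuous_const (by fun_prop)
  have hsub : Prod.fst '' connectedComponentIn (energySurface μ c) (q, p) ⊆
      {x : Plane | saddleAbscissa μ ≤ x 0} := by
    rintro _ ⟨z, hz, rfl⟩
    exact (hgt z hz).le
  have : saddleAbscissa μ ≤ earth 0 := closure_minimal hsub hclosed hcl
  rw [earth_zero] at this
  linarith [saddleAbscissa_pos h0 (show μ < 1 by linarith)]

/-! ### Failure of fiberwise convexity for unequal masses -/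

/-- The lift of covectors at `p` to covectors at `invStereo p`, as a linear map into the tangent
plane of the sphere. -/
def fiberMap (p : Plane) : Plane →ₗ[ℝ] ((ℝ ∙ invStereo p)ᗮ : Submodule ℝ Space) where
  toFun q := ⟨covectorLift q p, Submodule.mem_orthogonal_singleton_iff_inner_right.2 (by
    simpa [toCotangentSphere] using (toCotangentSphere_mem 0 (q, p)).2)⟩
  map_add' q r := by
    apply Subtype.ext
    change covectorLift (q + r) p = covectorLift q p + covectorLift r p
    ext i
    fin_cases i <;> simp [covectorLift, inner_add_left] <;> ring
  map_smul' t q := by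
    apply Subtype.ext
    change covectorLift (t • q) p = t • covectorLift q p
    ext i
    fin_cases i <;> simp [covectorLift, inner_smul_left] <;> ring

theorem coe_fiberMap (p q : Plane) : (fiberMap p q : Space) = covectorLift q p := rfl

theorem norm_covectorLift (q p : Plane) : ‖covectorLift q p‖ = (‖p‖ ^ 2 + 1) / 2 * ‖q‖ := by
  refine (sq_eq_sq₀ (norm_nonneg _) (by positivity)).1 ?_
  rw [mul_pow, EuclideanSpace.real_norm_sq_eq, Fin.sum_univ_three]
  simp only [covectorLift, inner_eq, norm_sq_eq]
  simp
  ring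

theorem fiberMap_injective (p : Plane) : Function.Injective (fiberMap p) := by
  rw [injective_iff_map_eq_zero]
  intro q hq
  have h := norm_covectorLift q p
  rw [← coe_fiberMap, hq] at h
  simp only [ZeroMemClass.coe_zero, norm_zero, zero_eq_mul, norm_eq_zero] at h
  exact h.resolve_left (by positivity)

/-- The boundary of a strictly convex domain contains no interior point of a segment between
midpoints of its points. -/
theorem BoundsStrictlyConvexDomain.notMem {V : Type*} [NormedAddCommGroup V] [NormedSpace ℝ V]
    {S : Set V} (h : BoundsStrictlyConvexDomain S) {a b a' b' : V} (ha : a ∈ S) (hb : b ∈ S)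
    (ha' : a' ∈ S) (hb' : b' ∈ S)
    (hne : (1 / 2 : ℝ) • a + (1 / 2 : ℝ) • b ≠ (1 / 2 : ℝ) • a' + (1 / 2 : ℝ) • b') {s t : ℝ}
    (hs : 0 < s) (ht : 0 < t) (hst : s + t = 1) :
    s • ((1 / 2 : ℝ) • a + (1 / 2 : ℝ) • b) + t • ((1 / 2 : ℝ) • a' + (1 / 2 : ℝ) • b') ∉ S := by
  obtain ⟨D, hD, hc, -, rfl⟩ := h
  have hsub := hD.isClosed.frontier_subset
  have hmid : ∀ {x y : V}, x ∈ frontier D → y ∈ frontier D →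
      (1 / 2 : ℝ) • x + (1 / 2 : ℝ) • y ∈ D := fun hx hy =>
    hc.convex (hsub hx) (hsub hy) (by norm_num) (by norm_num) (by norm_num)
  intro hmem
  exact hmem.2 (hc (hmid ha hb) (hmid ha' hb') hne hs ht hst)

/-- A level curve through two points `(x₁, ± y₁)`, `(x₂, ± y₂)` and a point `((x₁ + x₂) / 2, y)`
below the chord cannot bound a strictly convex domain. -/
theorem not_boundsStrictlyConvexDomain_of_chord {V : Type*} [NormedAddCommGroup V]
    [NormedSpace ℝ V] {S : Set V} (L : Plane →ₗ[ℝ] V) (hL : Function.Injective L)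
    {x₁ x₂ y₁ y₂ y : ℝ} (h1 : L !₂[x₁, y₁] ∈ S) (h1' : L !₂[x₁, -y₁] ∈ S)
    (h2 : L !₂[x₂, y₂] ∈ S) (h2' : L !₂[x₂, -y₂] ∈ S) (h : L !₂[(x₁ + x₂) / 2, y] ∈ S)
    (hy0 : 0 ≤ y) (hy : y < (y₁ + y₂) / 2) : ¬ BoundsStrictlyConvexDomain S := by
  intro hS
  set Y := (y₁ + y₂) / 2 with hY
  have hYpos : 0 < Y := hy0.trans_lt hy
  refine hS.notMem h1 h2 h1' h2' ?_ (s := (Y + y) / (2 * Y)) (t := (Y - y) / (2 * Y))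
    (by positivity) (div_pos (by linarith) (by positivity)) (by field_simp; ring) ?_
  · simp only [← map_smul, ← map_add]
    intro he
    have := congrArg (· 1) (hL he)
    simp at this
    linarith
  · simp only [← map_smul, ← map_add]
    convert h using 2
    ext i
    fin_cases i
    · simp
      field_simp
      ring
    · simp
      rw [show y₁ = 2 * Y - y₂ by rw [hY]; ring]
      field_simp
      ring

theorem fiberMap_zero_mem {μ c : ℝ} (h0 : 0 < μ) (h1 : μ ≤ 1 / 2) {x y : ℝ} (hx0 : 0 < x)
    (hx : x < saddleAbscissa μ) (hU : potential μ !₂[x, y] = c) :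
    fiberMap 0 !₂[x, y] ∈ {v : ((ℝ ∙ invStereo 0)ᗮ : Submodule ℝ Space) |
      (invStereo 0, (v : Space)) ∈ regularizedComponent μ c earth} := by
  refine subset_closure ⟨(!₂[x, y], 0), mem_primaryComponent_earth h0 h1 ?_ (by simpa using hx)
    (by simp [hamiltonian, hU]), ?_⟩
  · intro h
    have := congrArg (· 0) h
    simp [earth] at this
    linarith
  · simp [toCotangentSphere, coe_fiberMap, earth_eq_zero]

theorem neg_one_le_potential {μ : ℝ} (h0 : 0 < μ) (h1 : μ < 1) {q : Plane} (hq : 1 ≤ q 1) :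
    -1 ≤ potential μ q := by
  have h : ∀ P : Plane, P 1 = 0 → ‖q - P‖⁻¹ ≤ 1 := by
    intro P hP
    refine inv_le_one_of_one_le₀ (one_le_sq_iff₀ (norm_nonneg _) |>.1 ?_)
    rw [norm_sq_eq]
    simp only [PiLp.sub_apply, hP, sub_zero]
    nlinarith [sq_nonneg (q 0 - P 0)]
  rw [potential_eq]
  nlinarith [h earth earth_one, h moon moon_one]

theorem continuous_vertical (x : ℝ) : Continuous fun y : ℝ => (!₂[x, y] : Plane) := by
  refine (PiLp.continuous_toLp 2 _).comp (continuous_pi fun i => ?_)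
  fin_cases i <;> simp <;> fun_prop

theorem vertical_ne_centers {x : ℝ} (hx0 : 0 < x) (hx1 : x < 1) (y : ℝ) :
    (!₂[x, y] : Plane) ≠ earth ∧ (!₂[x, y] : Plane) ≠ moon := by
  refine ⟨fun h => ?_, ne_moon_of_lt_one (by simpa using hx1)⟩
  have := congrArg (· 0) h
  simp [earth] at this
  linarith

theorem continuous_potential_vertical (μ : ℝ) {x : ℝ} (hx0 : 0 < x) (hx1 : x < 1) :
    Continuous fun y : ℝ => potential μ !₂[x, y] := by
  rw [continuous_iff_continuousAt]
  intro y
  exact ContinuousAt.comp (f := fun y : ℝ => (!₂[x, y] : Plane))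
    (continuousAt_potential μ (vertical_ne_centers hx0 hx1 y).1 (vertical_ne_centers hx0 hx1 y).2)
    (continuous_vertical x).continuousAt

theorem potential_vertical_neg (μ x y : ℝ) : potential μ !₂[x, -y] = potential μ !₂[x, y] := by
  simp [potential, EuclideanSpace.norm_eq, earth, moon]

/-- Above a point where the potential is less than `c` lies a point where it equals `c`. -/
theorem exists_vertical_potential_eq {μ c : ℝ} (h0 : 0 < μ) (h1 : μ < 1) (hc : c < -1) {x y : ℝ}
    (hx0 : 0 < x) (hx1 : x < 1) (hy : potential μ !₂[x, y] < c) :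
    ∃ Y, y < Y ∧ potential μ !₂[x, Y] = c := by
  have hy1 : y ≤ 1 := by
    by_contra h
    have := neg_one_le_potential h0 h1 (q := !₂[x, y]) (by simp; linarith)
    linarith
  have htop := neg_one_le_potential h0 h1 (q := !₂[x, 1]) (by simp)
  obtain ⟨Y, hY, hYc⟩ := intermediate_value_Icc hy1
    (continuous_potential_vertical μ hx0 hx1).continuousOn ⟨hy.le, by linarith⟩
  refine ⟨Y, lt_of_le_of_ne hY.1 ?_, hYc⟩
  rintro rfl
  exact hy.ne hYc

/-- The critical level curve has points to the left of the saddle point, arbitrarily close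
to it. -/
theorem exists_mem_critical_level {μ δ : ℝ} (h0 : 0 < μ) (h1 : μ ≤ 1 / 2) (hδ : 0 < δ) :
    ∃ x y : ℝ, 0 < x ∧ x < saddleAbscissa μ ∧ 0 < y ∧ potential μ !₂[x, y] = criticalEnergy μ ∧
      potential μ !₂[x, 0] < criticalEnergy μ ∧ dist !₂[x, y] (saddle μ) < δ := by
  have hμ1 : μ < 1 := by linarith
  have hl0 := saddleAbscissa_pos h0 hμ1
  have hl1 := saddleAbscissa_lt_one h0 hμ1
  set l := saddleAbscissa μ with hl
  have hup : criticalEnergy μ < potential μ !₂[l, δ / 2] := by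
    rw [← potential_saddle]
    refine potential_lt_of_vertical h0 hμ1 (saddle_ne_earth h0 hμ1) (saddle_ne_moon h0 hμ1)
      (by simp [saddle, hl]) ?_
    simp [saddle]
    positivity
  have hcont : ContinuousAt (fun x : ℝ => potential μ !₂[x, δ / 2]) l := by
    refine ContinuousAt.comp (f := fun x : ℝ => (!₂[x, δ / 2] : Plane))
      (continuousAt_potential μ (vertical_ne_centers hl0 hl1 _).1
      (vertical_ne_centers hl0 hl1 _).2) (Continuous.continuousAt ?_)
    refine (PiLp.continuous_toLp 2 _).comp (continuous_pi fun i => ?_)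
    fin_cases i <;> simp <;> fun_prop
  have hev := hcont.eventually_const_lt hup
  obtain ⟨x, hx1, hx2, hx3⟩ := ((hev.filter_mono nhdsWithin_le_nhds).and
    (Ioo_mem_nhdsLT (show max 0 (l - δ / 2) < l from max_lt hl0 (by linarith)))).exists
  have hx0 : 0 < x := (le_max_left _ _).trans_lt hx2
  have hxδ : l - δ / 2 < x := (le_max_right _ _).trans_lt hx2
  have hlow : potential μ !₂[x, 0] < criticalEnergy μ := by
    rw [← potential_saddle]
    have : (!₂[x, 0] : Plane) = (x / l) • saddle μ := by
      ext i
      fin_cases i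
      · simp [saddle, ← hl]; field_simp
      · simp [saddle]
    rw [this]
    exact potential_smul_lt h0 h1 (saddle_ne_earth h0 hμ1) (saddle_zero μ).le (by positivity)
      ((div_lt_one hl0).2 hx3)
  obtain ⟨y, hy, hyc⟩ := intermediate_value_Icc (show (0 : ℝ) ≤ δ / 2 by positivity)
    (continuous_potential_vertical μ hx0 (hx3.trans hl1)).continuousOn ⟨hlow.le, hx1.le⟩
  refine ⟨x, y, hx0, hx3, lt_of_le_of_ne hy.1 ?_, hyc, hlow, ?_⟩
  · rintro rfl
    exact hlow.ne hyc
  · rw [dist_eq_norm]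
    refine lt_of_pow_lt_pow_left₀ 2 hδ.le ?_
    rw [norm_sq_eq]
    simp [saddle, ← hl]
    nlinarith [hy.1, hy.2]

/-- The level curve slightly below the critical energy passes above the ends and below the middle of
a short segment tangent to the critical level curve, which contradicts convexity of the fiber over
`p = 0`. -/
theorem exists_not_fiberwiseConvex {μ : ℝ} (h0 : 0 < μ) (h1 : μ < 1 / 2) :
    ∃ c₀ : ℝ, c₀ < criticalEnergy μ ∧ ∀ c : ℝ, c₀ < c → c < criticalEnergy μ →
      ¬ FiberwiseConvex (regularizedComponent μ c earth) := by
  have hμ1 : μ < 1 := by linarith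
  have hl1 := saddleAbscissa_lt_one h0 hμ1
  obtain ⟨δ, hδ, hneg⟩ := exists_potentialHess_levelTangent_neg h0 h1
  obtain ⟨x, y, hx0, hxl, hy0, hxy, hx, hd⟩ := exists_mem_critical_level h0 h1.le hδ
  obtain ⟨hE, hM, hH⟩ := hneg _ hxy (by simpa using hxl) hd
  set v := levelTangent μ !₂[x, y] with hv
  have hlt := eventually_potential_levelTangent_lt hE hM hH
  rw [← hv, hxy] at hlt
  -- Both endpoints of a short tangent segment at `(x, y)` lie below the critical energy.
  have hpos : ∀ᶠ s : ℝ in 𝓝 0, (0 < x + s * v 0 ∧ x + s * v 0 < saddleAbscissa μ) ∧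
      0 < y + s * v 1 := by
    have c0 : ContinuousAt (fun s : ℝ => x + s * v 0) 0 := by fun_prop
    have c1 : ContinuousAt (fun s : ℝ => y + s * v 1) 0 := by fun_prop
    exact ((c0.eventually_const_lt (by simpa using hx0)).and
      (c0.eventually_lt_const (by simpa using hxl))).and
      (c1.eventually_const_lt (by simpa using hy0))
  obtain ⟨ε, hε, hball⟩ := Metric.eventually_nhds_iff.1 (hlt.and hpos)
  have hs1 := hball (y := ε / 2) (by simp [abs_of_pos hε]; linarith)
  have hs2 := hball (y := -(ε / 2)) (by simp [abs_of_pos hε]; linarith)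
  have hform : ∀ s : ℝ, (!₂[x, y] : Plane) + s • v = !₂[x + s * v 0, y + s * v 1] := by
    intro s; ext i; fin_cases i <;> simp
  rw [hform] at hs1 hs2
  obtain ⟨a1, ⟨a2, a3⟩, a4⟩ := hs1
  obtain ⟨b1, ⟨b2, b3⟩, b4⟩ := hs2
  have a1 := a1 (by positivity)
  have b1 := b1 (by simp; positivity)
  have hcJ : criticalEnergy μ ≤ -1 := by
    rw [criticalEnergy_eq h0 hμ1]
    have := Real.sqrt_nonneg (μ * (1 - μ))
    linarith
  refine ⟨_, max_lt a1 (max_lt b1 hx), fun c hc hc' hconv => ?_⟩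
  obtain ⟨hca, hcb, hcx⟩ : _ ∧ _ ∧ _ := by simpa only [max_lt_iff] using hc
  obtain ⟨Y₁, hY₁, hU₁⟩ := exists_vertical_potential_eq h0 hμ1 (by linarith) a2 (a3.trans hl1) hca
  obtain ⟨Y₂, hY₂, hU₂⟩ := exists_vertical_potential_eq h0 hμ1 (by linarith) b2 (b3.trans hl1) hcb
  obtain ⟨Y, hY, hU⟩ := intermediate_value_Icc hy0.le
    (continuous_potential_vertical μ hx0 (hxl.trans hl1)).continuousOn
    ⟨hcx.le, by simp only [hxy]; exact hc'.le⟩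
  have hS := hconv (invStereo 0) (toCotangentSphere_mem 0 (0, 0)).1
  refine not_boundsStrictlyConvexDomain_of_chord (fiberMap 0) (fiberMap_injective 0)
    (fiberMap_zero_mem h0 h1.le a2 a3 hU₁)
    (fiberMap_zero_mem h0 h1.le a2 a3 (by rw [potential_vertical_neg, hU₁]))
    (fiberMap_zero_mem h0 h1.le b2 b3 hU₂)
    (fiberMap_zero_mem h0 h1.le b2 b3 (by rw [potential_vertical_neg, hU₂]))
    (y := Y) ?_ hY.1 ?_ hS
  · rw [show (x + ε / 2 * v 0 + (x + -(ε / 2) * v 0)) / 2 = x by ring]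
    exact fiberMap_zero_mem h0 h1.le hx0 hxl hU
  · linarith [hY.2]

/-! ### Convexity of the sublevel sets for equal masses -/

/-- The harmonic combination `r ρ / (r + ρ)` of the distances to the two centers, which for equal
masses is `-1 / (2 U)`. Unlike `U` it is continuous on the whole plane: it vanishes at the centers. -/
def harmonicDist (q : Plane) : ℝ := ‖q‖ * ‖q - moon‖ / (‖q‖ + ‖q - moon‖)

theorem norm_moon : ‖moon‖ = 1 := by simp [moon, EuclideanSpace.norm_eq]

theorem one_le_norm_add_norm (q : Plane) : 1 ≤ ‖q‖ + ‖q - moon‖ := by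
  have : ‖moon‖ ≤ ‖q‖ + ‖q - moon‖ := by
    have h := norm_sub_le q (q - moon)
    rwa [sub_sub_cancel] at h
  rwa [norm_moon] at this

theorem continuous_harmonicDist : Continuous harmonicDist := by
  unfold harmonicDist
  refine Continuous.div (by fun_prop) (by fun_prop) fun q => ?_
  have := one_le_norm_add_norm q
  positivity

theorem harmonicDist_zero : harmonicDist 0 = 0 := by simp [harmonicDist]

theorem harmonicDist_moon : harmonicDist moon = 0 := by simp [harmonicDist]

theorem ne_centers_of_harmonicDist_pos {q : Plane} (h : 0 < harmonicDist q) :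
    q ≠ earth ∧ q ≠ moon := by
  constructor <;> rintro rfl
  · rw [earth_eq_zero, harmonicDist_zero] at h; exact lt_irrefl _ h
  · rw [harmonicDist_moon] at h; exact lt_irrefl _ h

theorem harmonicDist_pos {q : Plane} (hE : q ≠ earth) (hM : q ≠ moon) : 0 < harmonicDist q := by
  have h1 : 0 < ‖q‖ := norm_pos_iff.2 (by rwa [← earth_eq_zero])
  have h2 : 0 < ‖q - moon‖ := norm_pos_iff.2 (sub_ne_zero.2 hM)
  unfold harmonicDist
  positivity

theorem harmonicDist_mul_potential {q : Plane} (hE : q ≠ earth) (hM : q ≠ moon) :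
    harmonicDist q * (-2 * potential (1 / 2) q) = 1 := by
  have h1 : 0 < ‖q‖ := norm_pos_iff.2 (by rwa [← earth_eq_zero])
  have h2 : 0 < ‖q - moon‖ := norm_pos_iff.2 (sub_ne_zero.2 hM)
  rw [harmonicDist, potential, earth_eq_zero, sub_zero]
  field_simp
  ring

theorem potential_half_eq {q : Plane} (hE : q ≠ earth) (hM : q ≠ moon) :
    potential (1 / 2) q = -(1 / (2 * harmonicDist q)) := by
  have := harmonicDist_mul_potential hE hM
  have h := harmonicDist_pos hE hM
  field_simp
  linarith

theorem saddleAbscissa_half : saddleAbscissa (1 / 2) = 1 / 2 := by simp [saddleAbscissa]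

theorem norm_le_norm_sub_moon {q : Plane} (h : q 0 ≤ 1 / 2) : ‖q‖ ≤ ‖q - moon‖ := by
  refine le_of_sq_le_sq ?_ (norm_nonneg _)
  rw [norm_sq_eq, norm_sq_eq]
  simp only [PiLp.sub_apply, moon_zero, moon_one, sub_zero]
  linarith

theorem norm_le_two_mul_harmonicDist {q : Plane} (h : q 0 ≤ 1 / 2) :
    ‖q‖ ≤ 2 * harmonicDist q := by
  have h1 := norm_le_norm_sub_moon h
  have h2 := one_le_norm_add_norm q
  have h3 := norm_nonneg q
  rw [harmonicDist, ← mul_div_assoc, le_div_iff₀ (by linarith)]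
  nlinarith

theorem quarter_le_harmonicDist {q : Plane} (h : q 0 = 1 / 2) : 1 / 4 ≤ harmonicDist q := by
  have h1 := norm_le_two_mul_harmonicDist h.le
  have h2 : 1 / 2 ≤ ‖q‖ := by
    refine le_of_sq_le_sq ?_ (norm_nonneg _)
    rw [norm_sq_eq, h]
    nlinarith [sq_nonneg (q 1)]
  linarith

theorem harmonicDist_smul_lt {q : Plane} (hE : q ≠ 0) (hq : q 0 ≤ 1 / 2) {t : ℝ} (ht0 : 0 < t)
    (ht1 : t < 1) : harmonicDist (t • q) < harmonicDist q := by
  have hE' : q ≠ earth := by rwa [earth_eq_zero]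
  have htE : t • q ≠ earth := by rw [earth_eq_zero]; exact smul_ne_zero ht0.ne' hE
  have hM : q ≠ moon := ne_moon_of_lt_one (by linarith)
  have htM : t • q ≠ moon := by
    refine ne_moon_of_lt_one ?_
    simp only [PiLp.smul_apply, smul_eq_mul]
    nlinarith
  have h := potential_smul_lt (μ := 1 / 2) (by norm_num) le_rfl hE'
    (by rwa [saddleAbscissa_half]) ht0 ht1
  rw [potential_half_eq hE' hM, potential_half_eq htE htM, neg_lt_neg_iff] at h
  have h1 := harmonicDist_pos hE' hM
  have h2 := harmonicDist_pos htE htM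
  rw [one_div_lt_one_div (by positivity) (by positivity)] at h
  linarith

/-- A line cannot touch a level curve below the critical energy from the inside. -/
theorem not_eventually_harmonicDist_le {q v : Plane} (hv : v ≠ 0) (h0 : 0 < harmonicDist q)
    (h1 : harmonicDist q < 1 / 4) :
    ¬ ∀ᶠ s : ℝ in 𝓝 0, harmonicDist (q + s • v) ≤ harmonicDist q := by
  intro hev
  obtain ⟨hE, hM⟩ := ne_centers_of_harmonicDist_pos h0
  have hU : potential (1 / 2) q < -2 := by
    rw [potential_half_eq hE hM, neg_lt_neg_iff, lt_div_iff₀ (by positivity)]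
    linarith
  refine not_isLocalMax_line hv hE hM (potentialHess_levelTangent_pos hE hM hU) ?_
  have hc : Tendsto (fun s : ℝ => q + s • v) (𝓝 0) (𝓝 q) := by
    have : Continuous fun s : ℝ => q + s • v := by fun_prop
    simpa using this.tendsto 0
  filter_upwards [hev, hc.eventually (eventually_ne_centers hE hM)] with s hs hne
  have hp := harmonicDist_pos hne.1 hne.2
  simp only [zero_smul, add_zero]
  rw [potential_half_eq hE hM, potential_half_eq hne.1 hne.2, neg_le_neg_iff]
  gcongr

/-- The region bounded by the level curve around the origin. -/
def sublevelRegion (w : ℝ) : Set Plane := {q | q 0 ≤ 1 / 2 ∧ harmonicDist q ≤ w}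

/-- The sublevel region is strictly convex. If a segment left its interior, then among the copies of
the segment scaled from the origin there would be a first one that reaches the level curve, and it
would touch the curve from the inside. -/
theorem harmonicDist_lt_of_mem_segment {w : ℝ} (hw0 : 0 < w) (hw1 : w < 1 / 4) {a b : Plane}
    (ha : a ∈ sublevelRegion w) (hb : b ∈ sublevelRegion w) (hab : a ≠ b) {s : ℝ} (hs0 : 0 < s)
    (hs1 : s < 1) : harmonicDist (a + s • (b - a)) < w := by
  by_contra hcon
  have hcon : w ≤ harmonicDist (a + s • (b - a)) := not_lt.1 hcon
  have hcont : Continuous fun z : ℝ × ℝ => harmonicDist (z.2 • (a + z.1 • (b - a))) :=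
    continuous_harmonicDist.comp (by fun_prop)
  set T : Set (ℝ × ℝ) := (Set.Icc 0 1 ×ˢ Set.Icc 0 1) ∩
    {z | w ≤ harmonicDist (z.2 • (a + z.1 • (b - a)))} with hT
  have hTc : IsCompact T :=
    (isCompact_Icc.prod isCompact_Icc).inter_right (isClosed_le continuous_const hcont)
  obtain ⟨⟨s₁, t₁⟩, hmem, hmin⟩ := hTc.exists_isMinOn (f := Prod.snd)
    ⟨(s, 1), ⟨⟨hs0.le, hs1.le⟩, by simp⟩, by simpa using hcon⟩ continuous_snd.continuousOn
  have hbelow : ∀ σ ∈ Set.Icc (0 : ℝ) 1, ∀ t, 0 ≤ t → t < t₁ →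
      harmonicDist (t • (a + σ • (b - a))) < w := by
    intro σ hσ t ht0 ht1
    by_contra h
    have hle : t₁ ≤ t := hmin (a := (σ, t))
      ⟨⟨hσ, ht0, ht1.le.trans hmem.1.2.2⟩, not_lt.1 h⟩
    linarith
  have ht₁ : 0 < t₁ := by
    refine lt_of_le_of_ne hmem.1.2.1 ?_
    rintro rfl
    have := hmem.2
    simp only [Set.mem_ofPred_eq, zero_smul, harmonicDist_zero] at this
    linarith
  have hend : ∀ q ∈ sublevelRegion w, t₁ < 1 → harmonicDist (t₁ • q) < w := by
    intro q hq h1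
    by_cases h0 : q = 0
    · rw [h0, smul_zero, harmonicDist_zero]; exact hw0
    · exact (harmonicDist_smul_lt h0 hq.1 ht₁ h1).trans_le hq.2
  -- If no shrinking is needed, the touching point is the given one; otherwise it is not an endpoint.
  obtain ⟨s₂, hs₂0, hs₂1, hs₂⟩ : ∃ s₂ : ℝ, 0 < s₂ ∧ s₂ < 1 ∧
      w ≤ harmonicDist (t₁ • (a + s₂ • (b - a))) := by
    rcases hmem.1.2.2.lt_or_eq with h1 | h1
    · refine ⟨s₁, lt_of_le_of_ne hmem.1.1.1 ?_, lt_of_le_of_ne hmem.1.1.2 ?_, hmem.2⟩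
      · rintro rfl
        have h2 := hmem.2
        simp only [Set.mem_ofPred_eq, zero_smul, add_zero] at h2
        exact absurd (hend a ha h1) (not_lt.2 h2)
      · rintro rfl
        have h2 := hmem.2
        simp only [Set.mem_ofPred_eq, one_smul, add_sub_cancel] at h2
        exact absurd (hend b hb h1) (not_lt.2 h2)
    · simp only at h1
      exact ⟨s, hs0, hs1, by rw [h1, one_smul]; exact hcon⟩
  have hle : ∀ σ ∈ Set.Icc (0 : ℝ) 1, harmonicDist (t₁ • (a + σ • (b - a))) ≤ w := by
    intro σ hσ
    have hc : Continuous fun t : ℝ => harmonicDist (t • (a + σ • (b - a))) :=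
      continuous_harmonicDist.comp (by fun_prop)
    refine le_of_tendsto ((hc.tendsto t₁).mono_left (nhdsWithin_le_nhds (s := Set.Iio t₁))) ?_
    filter_upwards [Ioo_mem_nhdsLT ht₁] with t ht
    exact (hbelow σ hσ t ht.1.le ht.2).le
  have hw : harmonicDist (t₁ • (a + s₂ • (b - a))) = w :=
    le_antisymm (hle s₂ ⟨hs₂0.le, hs₂1.le⟩) hs₂
  refine not_eventually_harmonicDist_le (q := t₁ • (a + s₂ • (b - a))) (v := t₁ • (b - a))
    (smul_ne_zero ht₁.ne' (sub_ne_zero.2 hab.symm)) (by rw [hw]; exact hw0)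
    (by rw [hw]; exact hw1) ?_
  have hev : ∀ᶠ σ : ℝ in 𝓝 0, s₂ + σ ∈ Set.Icc (0 : ℝ) 1 := by
    have : ContinuousAt (fun σ : ℝ => s₂ + σ) 0 := by fun_prop
    refine this.eventually_mem ?_
    rw [add_zero]
    exact Icc_mem_nhds hs₂0 hs₂1
  filter_upwards [hev] with σ hσ
  rw [hw]
  convert hle _ hσ using 2
  module

/-- The level curve around the origin bounds a strictly convex domain. -/
theorem boundsStrictlyConvexDomain_level {w : ℝ} (hw0 : 0 < w) (hw1 : w < 1 / 4) :
    BoundsStrictlyConvexDomain {q : Plane | q 0 < 1 / 2 ∧ harmonicDist q = w} := by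
  have hclosed : IsClosed (sublevelRegion w) :=
    (isClosed_le (f := fun q : Plane => q 0) (by fun_prop) continuous_const).inter
      (isClosed_le continuous_harmonicDist continuous_const)
  have hopen : IsOpen {q : Plane | q 0 < 1 / 2 ∧ harmonicDist q < w} :=
    (isOpen_lt (f := fun q : Plane => q 0) (by fun_prop) continuous_const).inter
      (isOpen_lt continuous_harmonicDist continuous_const)
  have hlt : ∀ q ∈ sublevelRegion w, q 0 < 1 / 2 := fun q hq =>
    lt_of_le_of_ne hq.1 fun h => by
      have := quarter_le_harmonicDist h
      linarith [hq.2]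
  have hint : {q : Plane | q 0 < 1 / 2 ∧ harmonicDist q < w} ⊆ interior (sublevelRegion w) :=
    interior_maximal (fun q hq => ⟨hq.1.le, hq.2.le⟩) hopen
  refine ⟨sublevelRegion w, ?_, ?_, ⟨0, hint ⟨by simp, by rwa [harmonicDist_zero]⟩⟩, ?_⟩
  · refine Metric.isCompact_of_isClosed_isBounded hclosed
      ((Metric.isBounded_closedBall (x := 0) (r := 2 * w)).subset fun q hq => ?_)
    rw [mem_closedBall_zero_iff]
    linarith [norm_le_two_mul_harmonicDist hq.1, hq.2]
  · intro a ha b hb hab s t hs ht hst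
    apply hint
    have he : s • a + t • b = a + t • (b - a) := by
      rw [show s = 1 - t by linarith]; module
    refine ⟨?_, ?_⟩
    · have h1 := hlt a ha
      have h2 := hlt b hb
      simp only [PiLp.add_apply, PiLp.smul_apply, smul_eq_mul]
      have : s = 1 - t := by linarith
      subst this
      nlinarith
    · rw [he]
      exact harmonicDist_lt_of_mem_segment hw0 hw1 ha hb hab ht (by linarith)
  · rw [hclosed.frontier_eq]
    ext q
    constructor
    · rintro ⟨hq, hq'⟩
      refine ⟨hlt q hq, le_antisymm hq.2 ?_⟩
      by_contra h
      exact hq' (hint ⟨hlt q hq, not_le.1 h⟩)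
    · rintro ⟨h1, h2⟩
      refine ⟨⟨h1.le, h2.le⟩, fun hmem => ?_⟩
      -- Moving outwards along the ray leaves the region.
      have hc : Tendsto (fun t : ℝ => t • q) (𝓝 1) (𝓝 q) := by
        have : Continuous fun t : ℝ => t • q := by fun_prop
        simpa using this.tendsto 1
      obtain ⟨t, ht, ht1⟩ := (((hc.eventually (isOpen_interior.mem_nhds hmem)).filter_mono
        (nhdsWithin_le_nhds (s := Set.Ioi 1))).and self_mem_nhdsWithin).exists
      have hmem' := interior_subset ht
      have ht1 : 1 < t := ht1
      have hq0 : q ≠ 0 := by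
        rintro rfl
        rw [harmonicDist_zero] at h2
        exact hw0.ne h2
      have := harmonicDist_smul_lt (q := t • q) (smul_ne_zero (by positivity) hq0) hmem'.1
        (t := t⁻¹) (by positivity) (inv_lt_one_of_one_lt₀ ht1)
      rw [smul_smul, inv_mul_cancel₀ (by positivity), one_smul, h2] at this
      linarith [hmem'.2]

/-- The component around the origin for equal masses. -/
theorem mem_primaryComponent_half_iff {c : ℝ} (hc : c < -2) {q p : Plane} :
    (q, p) ∈ primaryComponent (1 / 2) c earth ↔
      q 0 < 1 / 2 ∧ harmonicDist q * (‖p‖ ^ 2 - 2 * c) = 1 := by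
  rw [mem_primaryComponent_earth_iff (by norm_num) le_rfl (by rwa [criticalEnergy_half]),
    saddleAbscissa_half]
  have hpc : 0 < ‖p‖ ^ 2 - 2 * c := by have := sq_nonneg ‖p‖; linarith
  constructor
  · rintro ⟨hE, hq, hH⟩
    refine ⟨hq, ?_⟩
    rw [← harmonicDist_mul_potential hE (ne_moon_of_lt_one (by linarith)), ← hH, hamiltonian]
    ring
  · rintro ⟨hq, hH⟩
    have hpos : 0 < harmonicDist q := pos_of_mul_pos_left (by rw [hH]; norm_num) hpc.le
    obtain ⟨hE, hM⟩ := ne_centers_of_harmonicDist_pos hpos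
    refine ⟨hE, hq, ?_⟩
    have h2 := harmonicDist_mul_potential hE hM
    have := mul_left_cancel₀ hpos.ne' (hH.trans h2.symm)
    rw [hamiltonian]
    linarith

theorem boundsStrictlyConvexDomain_primaryComponent {c : ℝ} (hc : c < -2) (p : Plane) :
    BoundsStrictlyConvexDomain {q : Plane | (q, p) ∈ primaryComponent (1 / 2) c earth} := by
  have hp := sq_nonneg ‖p‖
  have hpc : 4 < ‖p‖ ^ 2 - 2 * c := by linarith
  convert boundsStrictlyConvexDomain_level (w := 1 / (‖p‖ ^ 2 - 2 * c)) (by positivity)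
    (one_div_lt_one_div_of_lt (by norm_num) hpc) using 1
  ext q
  simp only [Set.mem_ofPred_eq, mem_primaryComponent_half_iff hc]
  rw [eq_div_iff (by positivity)]

theorem potential_lt_of_mem_primaryComponent {c : ℝ} (hc : c < -2) {P q p : Plane}
    (h : (q, p) ∈ primaryComponent (1 / 2) c P) :
    q ≠ earth ∧ q ≠ moon ∧ potential (1 / 2) q < -2 := by
  obtain ⟨⟨hE, hM, hH⟩, -⟩ := h
  simp only at hE hM hH
  refine ⟨hE, hM, ?_⟩
  rw [hamiltonian] at hH
  have := sq_nonneg ‖p‖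
  linarith

/-! ### The regularized component for equal masses -/

/-- Bounding a strictly convex domain is invariant under affine homeomorphisms. -/
theorem BoundsStrictlyConvexDomain.image {V W : Type*} [NormedAddCommGroup V] [NormedSpace ℝ V]
    [NormedAddCommGroup W] [NormedSpace ℝ W] {S : Set V} (h : BoundsStrictlyConvexDomain S)
    (f : V →ᵃ[ℝ] W) (e : V ≃ₜ W) (he : ⇑e = f) : BoundsStrictlyConvexDomain (e '' S) := by
  obtain ⟨D, hD, hc, hi, rfl⟩ := h
  refine ⟨e '' D, hD.image e.continuous, ?_, ?_, (e.image_frontier D).symm⟩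
  · rw [he]
    exact hc.affine_image (by rw [← he]; exact e.isOpenMap)
  · rw [← e.image_interior]
    exact hi.image e

/-- The identification of covectors at `p` with covectors at `invStereo p`. -/
def fiberEquiv (p : Plane) : Plane ≃L[ℝ] ((ℝ ∙ invStereo p)ᗮ : Submodule ℝ Space) :=
  haveI : Fact (Module.finrank ℝ Space = 2 + 1) := ⟨by simp⟩
  (LinearEquiv.ofInjectiveOfFinrankEq (fiberMap p) (fiberMap_injective p) (by
    rw [Submodule.finrank_orthogonal_span_singleton (n := 2)]
    · simp
    · intro h
      have := (toCotangentSphere_mem 0 (0, p)).1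
      simp [toCotangentSphere, h] at this)).toContinuousLinearEquiv

theorem coe_fiberEquiv (p q : Plane) : (fiberEquiv p q : Space) = covectorLift q p := rfl

/-- The base point in the plane of a covector on the sphere. At the north pole it has a junk
value. -/
def stereoBase (z : Space × Space) : Plane := !₂[z.1 0 / (1 - z.1 2), z.1 1 / (1 - z.1 2)]

/-- The covector in the plane of a covector on the sphere. At the north pole it is zero. -/
def stereoCovector (z : Space × Space) : Plane :=
  !₂[(1 - z.1 2) * z.2 0 + z.1 0 * z.2 2, (1 - z.1 2) * z.2 1 + z.1 1 * z.2 2]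

theorem one_sub_invStereo (p : Plane) : 1 - invStereo p 2 = 2 / (‖p‖ ^ 2 + 1) := by
  have : ‖p‖ ^ 2 + 1 ≠ 0 := by positivity
  simp [invStereo]
  field_simp
  ring

theorem stereoBase_lift (q p : Plane) : stereoBase (invStereo p, covectorLift q p) = p := by
  have : ‖p‖ ^ 2 + 1 ≠ 0 := by positivity
  ext i
  fin_cases i <;> simp [stereoBase, one_sub_invStereo] <;> simp [invStereo] <;> field_simp

theorem stereoCovector_lift (q p : Plane) : stereoCovector (invStereo p, covectorLift q p) = q := by
  have : ‖p‖ ^ 2 + 1 ≠ 0 := by positivity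
  ext i
  fin_cases i <;> simp [stereoCovector, one_sub_invStereo] <;> simp [invStereo, covectorLift] <;>
    field_simp <;> ring

theorem invStereo_stereoBase {x y : Space} (hx : ‖x‖ = 1) (h : x 2 ≠ 1) :
    invStereo (stereoBase (x, y)) = x := by
  have h1 : 1 - x 2 ≠ 0 := sub_ne_zero.2 h.symm
  have hn : x 0 ^ 2 + x 1 ^ 2 + x 2 ^ 2 = 1 := by
    have := EuclideanSpace.real_norm_sq_eq x
    rw [hx, Fin.sum_univ_three] at this
    linarith
  have hp : ‖stereoBase (x, y)‖ ^ 2 = (1 + x 2) / (1 - x 2) := by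
    rw [norm_sq_eq]
    simp [stereoBase]
    field_simp
    linear_combination hn
  have hp1 : ‖stereoBase (x, y)‖ ^ 2 + 1 = 2 / (1 - x 2) := by rw [hp]; field_simp; ring
  ext i
  fin_cases i
  · simp [invStereo, hp1]; simp [stereoBase]; field_simp
  · simp [invStereo, hp1]; simp [stereoBase]; field_simp
  · simp [invStereo, hp1]; rw [hp]; field_simp; ring

theorem toCotangentSphere_earth (z : Plane × Plane) :
    toCotangentSphere earth z = (invStereo z.2, covectorLift z.1 z.2) := by
  rw [toCotangentSphere, earth_eq_zero, sub_zero]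

theorem continuous_stereoCovector : Continuous stereoCovector := by
  refine (PiLp.continuous_toLp 2 _).comp (continuous_pi fun i => ?_)
  fin_cases i <;> simp <;> fun_prop

theorem continuousAt_stereoBase {z : Space × Space} (h : z.1 2 ≠ 1) :
    ContinuousAt stereoBase z := by
  have h1 : 1 - z.1 2 ≠ 0 := sub_ne_zero.2 h.symm
  refine (PiLp.continuous_toLp 2 _).continuousAt.comp (continuousAt_pi.2 fun i => ?_)
  fin_cases i <;> simp
  · exact ContinuousAt.div (by fun_prop) (by fun_prop) h1
  · exact ContinuousAt.div (by fun_prop) (by fun_prop) h1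

theorem continuous_covectorLift : Continuous fun z : Plane × Plane => covectorLift z.1 z.2 := by
  refine (PiLp.continuous_toLp 2 _).comp (continuous_pi fun i => ?_)
  fin_cases i <;> simp <;> fun_prop

theorem exists_seq_of_mem_regularizedComponent {μ c : ℝ} {w : Space × Space}
    (h : w ∈ regularizedComponent μ c earth) :
    ∃ z : ℕ → Plane × Plane, (∀ n, z n ∈ primaryComponent μ c earth) ∧
      Tendsto (fun n => (invStereo (z n).2, covectorLift (z n).1 (z n).2)) atTop (𝓝 w) := by
  obtain ⟨u, hu, hlim⟩ := mem_closure_iff_seq_limit.1 h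
  choose z hz hzu using hu
  refine ⟨z, hz, ?_⟩
  convert hlim using 2 with n
  rw [← hzu, toCotangentSphere_earth]

/-- Away from the north pole the closure adds no points to the component. -/
theorem mem_regularizedComponent_invStereo {c : ℝ} (hc : c < -2) {p : Plane} {y : Space} :
    (invStereo p, y) ∈ regularizedComponent (1 / 2) c earth ↔
      ∃ q, (q, p) ∈ primaryComponent (1 / 2) c earth ∧ covectorLift q p = y := by
  constructor
  · intro h
    obtain ⟨z, hz, hlim⟩ := exists_seq_of_mem_regularizedComponent h
    have hne : invStereo p 2 ≠ 1 := by
      have h1 := one_sub_invStereo p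
      have h2 : 0 < 2 / (‖p‖ ^ 2 + 1) := by positivity
      intro h3
      rw [h3, sub_self] at h1
      exact h2.ne h1
    have hq := (continuous_stereoCovector.tendsto _).comp hlim
    have hp := (continuousAt_stereoBase (z := (invStereo p, y)) hne).tendsto.comp hlim
    simp only [Function.comp_def, stereoCovector_lift, stereoBase_lift] at hq hp
    have hbase : stereoBase (invStereo p, y) = p := stereoBase_lift 0 p
    rw [hbase] at hp
    set q := stereoCovector (invStereo p, y) with hqdef
    refine ⟨q, ?_, ?_⟩
    · rw [mem_primaryComponent_half_iff hc]
      have hz' := fun n => (mem_primaryComponent_half_iff hc (q := (z n).1) (p := (z n).2)).1 (hz n)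
      have hle : q 0 ≤ 1 / 2 := by
        have hc0 : Continuous fun x : Plane => x 0 := by fun_prop
        exact le_of_tendsto' ((hc0.tendsto q).comp hq) fun n => (hz' n).1.le
      have heq : harmonicDist q * (‖p‖ ^ 2 - 2 * c) = 1 := by
        have h1 := ((continuous_harmonicDist.tendsto q).comp hq).mul
          (((hp.norm).pow 2).sub_const (2 * c))
        refine tendsto_nhds_unique h1 ?_
        simp only [Function.comp_def, fun n => (hz' n).2]
        exact tendsto_const_nhds
      refine ⟨lt_of_le_of_ne hle fun h => ?_, heq⟩
      have := quarter_le_harmonicDist h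
      nlinarith [sq_nonneg ‖p‖]
    · have h1 := (continuous_covectorLift.tendsto (q, p)).comp (hq.prodMk_nhds hp)
      exact tendsto_nhds_unique h1 ((continuous_snd.tendsto _).comp hlim)
  · rintro ⟨q, hq, rfl⟩
    exact subset_closure ⟨(q, p), hq, toCotangentSphere_earth _⟩

/-- The energy equation in coordinates of the sphere, which extends to the north pole. -/
theorem norm_covectorLift_mul {c : ℝ} (hc : c < -2) {q p : Plane}
    (h : (q, p) ∈ primaryComponent (1 / 2) c earth) :
    ‖covectorLift q p‖ * (2 - (1 - invStereo p 2) * (1 + 2 * c + ‖q - moon‖⁻¹)) = 1 := by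
  obtain ⟨hE, hM, -⟩ := potential_lt_of_mem_primaryComponent hc h
  have h1 : 0 < ‖q‖ := norm_pos_iff.2 (by rwa [← earth_eq_zero])
  have h2 : 0 < ‖q - moon‖ := norm_pos_iff.2 (sub_ne_zero.2 hM)
  have h3 := ((mem_primaryComponent_half_iff hc).1 h).2
  rw [one_sub_invStereo, norm_covectorLift]
  rw [harmonicDist] at h3
  have h4 : ‖p‖ ^ 2 + 1 ≠ 0 := by positivity
  field_simp at h3 ⊢
  linarith

theorem norm_eq_half_of_mem_regularizedComponent {c : ℝ} (hc : c < -2) {x y : Space}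
    (hx : x 2 = 1) (hx0 : x 0 = 0) (hx1 : x 1 = 0)
    (h : (x, y) ∈ regularizedComponent (1 / 2) c earth) : ‖y‖ = 1 / 2 := by
  obtain ⟨z, hz, hlim⟩ := exists_seq_of_mem_regularizedComponent h
  have hq := (continuous_stereoCovector.tendsto _).comp hlim
  simp only [Function.comp_def, stereoCovector_lift] at hq
  have hq0 : stereoCovector (x, y) = 0 := by
    ext i
    fin_cases i <;> simp [stereoCovector, hx, hx0, hx1]
  rw [hq0] at hq
  have hM : Tendsto (fun n => ‖(z n).1 - moon‖⁻¹) atTop (𝓝 ‖(0 : Plane) - moon‖⁻¹) :=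
    (hq.sub_const moon).norm.inv₀ (by simp [norm_moon])
  have hy := ((continuous_snd.tendsto _).comp hlim).norm
  have hx' : Tendsto (fun n => invStereo (z n).2 2) atTop (𝓝 1) := by
    have hc2 : Continuous fun w : Space × Space => w.1 2 := by fun_prop
    have := (hc2.tendsto _).comp hlim
    simpa [Function.comp_def, hx] using this
  have hlim' := hy.mul (((hx'.const_sub 1).mul (hM.const_add (1 + 2 * c))).const_sub 2)
  have h1 := tendsto_nhds_unique hlim' (tendsto_const_nhds (x := (1 : ℝ)) |>.congr fun n =>
    (norm_covectorLift_mul hc (hz n)).symm)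
  simp only [sub_self, zero_mul, sub_zero] at h1
  linarith

/-- In every direction `u` and for every large momentum, the component contains a point of the ray
spanned by `u`. -/
theorem exists_smul_mem_primaryComponent {c : ℝ} (hc : c < -2) {u p : Plane} (hu : ‖u‖ = 1)
    (hp : 4 ≤ ‖p‖ ^ 2) : ∃ r : ℝ, 0 < r ∧ r * (‖p‖ ^ 2 - 2 * c) ≤ 2 ∧
      (r • u, p) ∈ primaryComponent (1 / 2) c earth := by
  have hpc : 8 < ‖p‖ ^ 2 - 2 * c := by linarith
  have hu0 : u 0 ≤ 1 := by
    have := norm_sq_eq u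
    rw [hu] at this
    nlinarith [sq_nonneg (u 1)]
  have hhalf : ∀ r ∈ Set.Icc (0 : ℝ) (1 / 4), (r • u) 0 < 1 / 2 := by
    intro r hr
    simp only [PiLp.smul_apply, smul_eq_mul]
    nlinarith [hr.1, hr.2]
  have hnorm : ∀ r : ℝ, 0 ≤ r → ‖r • u‖ = r := fun r hr => by
    rw [norm_smul, hu, mul_one, Real.norm_of_nonneg hr]
  have hcont : Continuous fun r : ℝ => harmonicDist (r • u) :=
    continuous_harmonicDist.comp (by fun_prop)
  have htop : 1 / (‖p‖ ^ 2 - 2 * c) ≤ harmonicDist ((1 / 4 : ℝ) • u) := by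
    have h1 := norm_le_two_mul_harmonicDist (hhalf (1 / 4) (by norm_num)).le
    rw [hnorm _ (by norm_num)] at h1
    have h2 := one_div_lt_one_div_of_lt (by norm_num) hpc
    linarith
  obtain ⟨r, hr, hrw⟩ := intermediate_value_Icc (show (0 : ℝ) ≤ 1 / 4 by norm_num)
    hcont.continuousOn ⟨by simp only [zero_smul, harmonicDist_zero]; positivity, htop⟩
  simp only at hrw
  have hmem : harmonicDist (r • u) * (‖p‖ ^ 2 - 2 * c) = 1 := by
    rw [hrw]; field_simp
  refine ⟨r, lt_of_le_of_ne hr.1 ?_, ?_, (mem_primaryComponent_half_iff hc).2 ⟨hhalf r hr, hmem⟩⟩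
  · rintro rfl
    rw [zero_smul, harmonicDist_zero] at hmem
    norm_num at hmem
  · have h1 := norm_le_two_mul_harmonicDist (hhalf r hr).le
    rw [hnorm _ hr.1] at h1
    nlinarith

/-- The quarter turn of the plane. -/
def quarterTurn (u : Plane) : Plane := !₂[-u 1, u 0]

theorem norm_quarterTurn (u : Plane) : ‖quarterTurn u‖ = ‖u‖ := by
  simp [quarterTurn, EuclideanSpace.norm_eq, add_comm]

/-- Every covector of length `1 / 2` at the north pole is a limit of points of the component: one
lets the momentum tend to infinity at a right angle to the position. -/
theorem mem_regularizedComponent_of_norm_eq_half {c : ℝ} (hc : c < -2) {x y : Space}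
    (hx : x 2 = 1) (hx0 : x 0 = 0) (hx1 : x 1 = 0) (hy2 : y 2 = 0) (hy : ‖y‖ = 1 / 2) :
    (x, y) ∈ regularizedComponent (1 / 2) c earth := by
  set u : Plane := !₂[2 * y 0, 2 * y 1] with hu
  have hu1 : ‖u‖ = 1 := by
    have h1 := EuclideanSpace.real_norm_sq_eq y
    rw [hy, Fin.sum_univ_three, hy2] at h1
    refine (sq_eq_sq₀ (norm_nonneg _) zero_le_one).1 ?_
    rw [norm_sq_eq]
    simp [hu]
    linarith
  have hpn : ∀ n : ℕ, ‖((n : ℝ) + 2) • quarterTurn u‖ = n + 2 := fun n => by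
    rw [norm_smul, norm_quarterTurn, hu1, mul_one, Real.norm_of_nonneg (by positivity)]
  choose r hr0 hr2 hr using fun n : ℕ => exists_smul_mem_primaryComponent hc
    (u := u) (p := ((n : ℝ) + 2) • quarterTurn u) hu1 (by
      rw [hpn]; nlinarith [(Nat.cast_nonneg n : (0 : ℝ) ≤ n)])
  have hatTop : Tendsto (fun n : ℕ => (n : ℝ) + 2) atTop atTop :=
    tendsto_atTop_add_const_right _ _ tendsto_natCast_atTop_atTop
  have hsq : Tendsto (fun n : ℕ => ((n : ℝ) + 2) ^ 2 - 2 * c) atTop atTop :=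
    tendsto_atTop_add_const_right _ _ ((tendsto_pow_atTop two_ne_zero).comp hatTop)
  have hsq1 : Tendsto (fun n : ℕ => ((n : ℝ) + 2) ^ 2 + 1) atTop atTop :=
    tendsto_atTop_add_const_right _ _ ((tendsto_pow_atTop two_ne_zero).comp hatTop)
  have hrlim : Tendsto r atTop (𝓝 0) := by
    refine squeeze_zero (fun n => (hr0 n).le) (fun n => ?_) (hsq.const_div_atTop 2)
    have := hr2 n
    rw [hpn] at this
    rwa [le_div_iff₀ (by nlinarith [(Nat.cast_nonneg n : (0 : ℝ) ≤ n)])]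
  have hmoon : Tendsto (fun n => ‖r n • u - moon‖⁻¹) atTop (𝓝 1) := by
    have h1 := ((hrlim.smul_const u).sub_const moon).norm.inv₀ (by simp [norm_moon])
    simpa [norm_moon] using h1
  have hb : Tendsto (fun n : ℕ => (((n : ℝ) + 2) ^ 2 + 1) * r n) atTop (𝓝 1) := by
    have h1 : Tendsto (fun n : ℕ => 1 + r n * (1 + 2 * c + ‖r n • u - moon‖⁻¹)) atTop
        (𝓝 (1 + 0 * (1 + 2 * c + 1))) :=
      (hrlim.mul (hmoon.const_add _)).const_add 1
    simp only [zero_mul, add_zero] at h1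
    refine h1.congr fun n => ?_
    obtain ⟨-, hM, -⟩ := potential_lt_of_mem_primaryComponent hc (hr n)
    have h2 : 0 < ‖r n • u - moon‖ := norm_pos_iff.2 (sub_ne_zero.2 hM)
    have h3 := ((mem_primaryComponent_half_iff hc).1 (hr n)).2
    rw [hpn, harmonicDist, norm_smul, hu1, mul_one, Real.norm_of_nonneg (hr0 n).le] at h3
    have h4 := hr0 n
    field_simp at h3 ⊢
    linarith
  refine mem_closure_of_tendsto (f := fun n : ℕ => (invStereo (((n : ℝ) + 2) • quarterTurn u),
    covectorLift (r n • u) (((n : ℝ) + 2) • quarterTurn u))) (b := atTop) ?_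
    (.of_forall fun n => ⟨_, hr n, toCotangentSphere_earth _⟩)
  have hinv : Tendsto (fun n : ℕ => 1 / (((n : ℝ) + 2) ^ 2 + 1)) atTop (𝓝 0) :=
    hsq1.const_div_atTop 1
  have hinv' : Tendsto (fun n : ℕ => ((n : ℝ) + 2) / (((n : ℝ) + 2) ^ 2 + 1)) atTop (𝓝 0) := by
    refine squeeze_zero (fun n => by positivity) (fun n => ?_) (hatTop.const_div_atTop 1)
    rw [div_le_div_iff₀ (by positivity) (by positivity)]
    nlinarith
  refine Tendsto.prodMk_nhds ?_ ?_
  · have hx' : x = WithLp.toLp 2 ![x 0, x 1, x 2] := by ext i; fin_cases i <;> rfl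
    rw [hx']
    refine ((PiLp.continuous_toLp 2 _).tendsto _).comp (tendsto_pi_nhds.2 fun i => ?_)
    simp only [hpn, hx, hx0, hx1]
    fin_cases i
    · have h1 := hinv'.const_mul (2 * -u 1)
      rw [mul_zero] at h1
      refine h1.congr fun n => ?_
      simp [quarterTurn]
      ring
    · have h1 := hinv'.const_mul (2 * u 0)
      rw [mul_zero] at h1
      refine h1.congr fun n => ?_
      simp [quarterTurn]
      ring
    · have h1 := (hinv.const_mul 2).const_sub 1
      rw [mul_zero, sub_zero] at h1
      refine h1.congr fun n => ?_
      simp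
      field_simp
      ring
  · have hy' : y = WithLp.toLp 2 ![y 0, y 1, y 2] := by ext i; fin_cases i <;> rfl
    rw [hy']
    have horth : ∀ n : ℕ, ⟪r n • u, ((n : ℝ) + 2) • quarterTurn u⟫ = 0 := fun n => by
      rw [inner_eq]; simp [quarterTurn]; ring
    refine ((PiLp.continuous_toLp 2 _).tendsto _).comp (tendsto_pi_nhds.2 fun i => ?_)
    simp only [hpn, hy2, horth]
    fin_cases i
    · have h1 := hb.mul_const (y 0)
      rw [one_mul] at h1
      refine h1.congr fun n => ?_
      simp [hu]
      ring
    · have h1 := hb.mul_const (y 1)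
      rw [one_mul] at h1
      refine h1.congr fun n => ?_
      simp [hu]
      ring
    · simp

theorem fiberwiseConvex_earth {c : ℝ} (hc : c < -2) :
    FiberwiseConvex (regularizedComponent (1 / 2) c earth) := by
  intro x hx
  by_cases h2 : x 2 = 1
  · have hn := EuclideanSpace.real_norm_sq_eq x
    rw [hx, Fin.sum_univ_three, h2] at hn
    have hx0 : x 0 = 0 := by
      refine pow_eq_zero_iff two_ne_zero |>.1 ?_
      nlinarith [sq_nonneg (x 0), sq_nonneg (x 1)]
    have hx1 : x 1 = 0 := by
      refine pow_eq_zero_iff two_ne_zero |>.1 ?_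
      nlinarith [sq_nonneg (x 0), sq_nonneg (x 1)]
    refine ⟨Metric.closedBall 0 (1 / 2), isCompact_closedBall _ _, strictConvex_closedBall ℝ _ _,
      ⟨0, Metric.ball_subset_interior_closedBall (by simp)⟩, ?_⟩
    rw [frontier_closedBall _ (by norm_num)]
    ext y
    have hy2 : (y : Space) 2 = 0 := by
      have h := Submodule.mem_orthogonal_singleton_iff_inner_right.1 y.2
      simpa [PiLp.inner_apply, Fin.sum_univ_three, h2, hx0, hx1] using h
    rw [mem_sphere_zero_iff_norm, Set.mem_ofPred_eq, Submodule.coe_norm]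
    exact ⟨mem_regularizedComponent_of_norm_eq_half hc h2 hx0 hx1 hy2,
      norm_eq_half_of_mem_regularizedComponent hc h2 hx0 hx1⟩
  · obtain ⟨p, rfl⟩ : ∃ p, invStereo p = x := ⟨_, invStereo_stereoBase (y := 0) hx h2⟩
    convert (boundsStrictlyConvexDomain_primaryComponent hc p).image
      (fiberEquiv p).toLinearEquiv.toLinearMap.toAffineMap (fiberEquiv p).toHomeomorph rfl using 1
    ext y
    rw [Set.mem_ofPred_eq, mem_regularizedComponent_invStereo hc]
    refine exists_congr fun q => and_congr Iff.rfl ?_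
    rw [← coe_fiberEquiv]
    exact Subtype.ext_iff.symm

/-! ### The reflection exchanging two equal masses -/

theorem potential_half_moon_sub (q : Plane) :
    potential (1 / 2) (moon - q) = potential (1 / 2) q := by
  have h1 : ‖moon - q - earth‖ = ‖q - moon‖ := by rw [earth_eq_zero, sub_zero, norm_sub_rev]
  have h2 : ‖moon - q - moon‖ = ‖q - earth‖ := by
    rw [earth_eq_zero, sub_zero, sub_sub_cancel_left, norm_neg]
  rw [potential_eq, potential_eq, h1, h2]
  ring

/-- The reflection of the positions at the midpoint of the centers. -/
def reflection : Plane × Plane ≃ₜ Plane × Plane :=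
  (Homeomorph.subLeft moon).prodCongr (Homeomorph.refl Plane)

theorem reflection_apply (z : Plane × Plane) : reflection z = (moon - z.1, z.2) := rfl

theorem reflection_reflection (z : Plane × Plane) : reflection (reflection z) = z := by
  simp [reflection_apply]

theorem reflection_mem_energySurface {c : ℝ} {z : Plane × Plane}
    (h : z ∈ energySurface (1 / 2) c) : reflection z ∈ energySurface (1 / 2) c := by
  obtain ⟨hE, hM, hH⟩ := h
  rw [reflection_apply]
  refine ⟨?_, ?_, ?_⟩
  · rw [earth_eq_zero]
    exact sub_ne_zero.2 hM.symm
  · intro h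
    exact hE (by rw [earth_eq_zero]; simpa using h)
  · rw [← hH, hamiltonian, hamiltonian]
    simp only [potential_half_moon_sub]

theorem image_reflection_energySurface (c : ℝ) :
    reflection '' energySurface (1 / 2) c = energySurface (1 / 2) c := by
  refine Set.Subset.antisymm ?_ fun z hz => ⟨reflection z, reflection_mem_energySurface hz,
    reflection_reflection z⟩
  rintro _ ⟨z, hz, rfl⟩
  exact reflection_mem_energySurface hz

theorem reflection_mem_primaryComponent {c : ℝ} {P : Plane} {z : Plane × Plane}
    (h : z ∈ primaryComponent (1 / 2) c P) :
    reflection z ∈ primaryComponent (1 / 2) c (moon - P) := by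
  refine ⟨reflection_mem_energySurface h.1, ?_⟩
  have h1 := reflection.image_connectedComponentIn h.1
  rw [image_reflection_energySurface] at h1
  rw [← h1, Set.image_image]
  have h2 : (fun w => (reflection w).1) '' connectedComponentIn (energySurface (1 / 2) c) z =
      Homeomorph.subLeft moon '' (Prod.fst '' connectedComponentIn (energySurface (1 / 2) c) z) := by
    rw [Set.image_image]; rfl
  rw [h2, ← Homeomorph.image_closure]
  exact ⟨P, h.2, rfl⟩

theorem mem_primaryComponent_moon_iff {c : ℝ} {z : Plane × Plane} :
    z ∈ primaryComponent (1 / 2) c moon ↔ reflection z ∈ primaryComponent (1 / 2) c earth := by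
  constructor
  · intro h
    simpa [earth_eq_zero] using reflection_mem_primaryComponent h
  · intro h
    have := reflection_mem_primaryComponent h
    rwa [reflection_reflection, earth_eq_zero, sub_zero] at this

theorem toCotangentSphere_moon (z : Plane × Plane) :
    toCotangentSphere moon z =
      ((toCotangentSphere earth (reflection z)).1, -(toCotangentSphere earth (reflection z)).2) := by
  rw [toCotangentSphere_earth, reflection_apply, toCotangentSphere]
  refine Prod.ext rfl ?_
  change covectorLift (z.1 - moon) z.2 = -covectorLift (moon - z.1) z.2
  rw [← coe_fiberMap, ← coe_fiberMap, ← neg_sub, map_neg]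
  rfl

theorem mem_regularizedComponent_moon {c : ℝ} {x y : Space} :
    (x, y) ∈ regularizedComponent (1 / 2) c moon ↔
      (x, -y) ∈ regularizedComponent (1 / 2) c earth := by
  set e : Space × Space ≃ₜ Space × Space := (Homeomorph.refl Space).prodCongr (Homeomorph.neg Space)
    with he
  have himg : toCotangentSphere moon '' primaryComponent (1 / 2) c moon =
      e '' (toCotangentSphere earth '' primaryComponent (1 / 2) c earth) := by
    rw [Set.image_image]
    ext w
    constructor
    · rintro ⟨z, hz, rfl⟩
      exact ⟨reflection z, mem_primaryComponent_moon_iff.1 hz, (toCotangentSphere_moon z).symm⟩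
    · rintro ⟨z, hz, rfl⟩
      refine ⟨reflection z, mem_primaryComponent_moon_iff.2 (by rwa [reflection_reflection]), ?_⟩
      rw [toCotangentSphere_moon, reflection_reflection]
      rfl
  rw [regularizedComponent, regularizedComponent, himg, ← Homeomorph.image_closure]
  constructor
  · rintro ⟨⟨a, b⟩, h, hab⟩
    obtain ⟨rfl, rfl⟩ := Prod.mk.inj hab
    simpa using h
  · intro h
    exact ⟨(x, -y), h, by simp [he]⟩

theorem fiberwiseConvex_moon {c : ℝ} (hc : c < -2) :
    FiberwiseConvex (regularizedComponent (1 / 2) c moon) := by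
  intro x hx
  convert (fiberwiseConvex_earth hc x hx).image
    (LinearMap.toAffineMap (-LinearMap.id)) (Homeomorph.neg _) rfl using 1
  ext y
  rw [Set.mem_ofPred_eq, mem_regularizedComponent_moon]
  constructor
  · intro h
    exact ⟨-y, h, neg_neg y⟩
  · rintro ⟨y', h, rfl⟩
    simpa using h

theorem boundsStrictlyConvexDomain_primaryComponent_moon {c : ℝ} (hc : c < -2) (p : Plane) :
    BoundsStrictlyConvexDomain {q : Plane | (q, p) ∈ primaryComponent (1 / 2) c moon} := by
  convert (boundsStrictlyConvexDomain_primaryComponent hc p).image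
    (AffineEquiv.constVSub ℝ moon).toAffineMap (Homeomorph.subLeft moon) rfl using 1
  ext q
  rw [Set.mem_ofPred_eq, mem_primaryComponent_moon_iff, reflection_apply]
  constructor
  · intro h
    exact ⟨moon - q, h, by simp⟩
  · rintro ⟨q', h, rfl⟩
    simpa using h

end EulerProblem

end

theorem theorem1p4 :
    (∀ μ : ℝ, 0 < μ → μ < 1 / 2 →
      (∃ c₀ : ℝ, c₀ < criticalEnergy μ ∧ ∀ c : ℝ, c₀ < c → c < criticalEnergy μ →
        ¬ FiberwiseConvex (regularizedComponent μ c earth)) ∧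
      (∃ δ : ℝ, 0 < δ ∧ ∀ q : Plane, potential μ q = criticalEnergy μ →
        q 0 < saddleAbscissa μ → dist q (saddle μ) < δ →
        levelCurvature (potential μ) q < 0)) ∧
    (∀ c : ℝ, c < criticalEnergy (1 / 2) → ∀ P : Plane, P = earth ∨ P = moon →
      FiberwiseConvex (regularizedComponent (1 / 2) c P) ∧
      ∀ p : Plane,
        BoundsStrictlyConvexDomain {q : Plane | (q, p) ∈ primaryComponent (1 / 2) c P} ∧
        ∀ q : Plane, (q, p) ∈ primaryComponent (1 / 2) c P →
          0 < levelCurvature (potential (1 / 2)) q) := by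
  refine ⟨fun μ h0 h1 => ⟨exists_not_fiberwiseConvex h0 h1, ?_⟩, fun c hc P hP => ?_⟩
  · obtain ⟨δ, hδ, h⟩ := exists_potentialHess_levelTangent_neg h0 h1
    refine ⟨δ, hδ, fun q hU hq hd => ?_⟩
    obtain ⟨hE, hM, hneg⟩ := h q hU hq hd
    exact levelCurvature_neg hE hM hneg
  · rw [criticalEnergy_half] at hc
    have hcurv : ∀ q p : Plane, (q, p) ∈ primaryComponent (1 / 2) c P →
        0 < levelCurvature (potential (1 / 2)) q := fun q p h => by
      obtain ⟨hE, hM, hU⟩ := potential_lt_of_mem_primaryComponent hc h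
      exact levelCurvature_half_pos hE hM hU
    rcases hP with rfl | rfl
    · exact ⟨fiberwiseConvex_earth hc, fun p =>
        ⟨boundsStrictlyConvexDomain_primaryComponent hc p, fun q => hcurv q p⟩⟩
    · exact ⟨fiberwiseConvex_moon hc, fun p =>
        ⟨boundsStrictlyConvexDomain_primaryComponent_moon hc p, fun q => hcurv q p⟩⟩
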